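/- Let $A$ be a (not necessarily unital or separable) $C^*$-algebra and let $I$ be a closed two-sided ideal of $A$. Write $\mathrm{Lat}(A)$ for the complete lattice of closed two-sided ideals of $A$ ordered by inclusion, $\mathrm{Ped}(I)$ for the Pedersen ideal of the $C^*$-algebra $I$ (its smallest dense two-sided ideal), and $\mathrm{Prim}(I)$ for the space of primitive ideals of $I$ with the hull-kernel topology. An element of $I$ is called full if the closed two-sided ideal it generates is $I$. The following are equivalent: (i) $I$ is singly generated (that is, generated by one element as a closed two-sided ideal) and is a compact element of $\mathrm{Lat}(A)$; (ii) $\mathrm{Ped}(I)$ contains a full element of $I$; (iii) $\mathrm{Prim}(I)$ is compact (every open cover has a finite subcover). Let $\mathrm{T}(A)$ be the cone of lower-semicontinuous traces on $A$, that is, of lower-semicontinuous maps $\tau\colon A_+\to[0,\infty]$ that are additive, compatible with multiplication by positive real numbers, and satisfy $\tau(0)=0$ and $\tau(xx^*)=\tau(x^*x)$ for all $x\in A$. Give it the pointwise operations and order, and the topology in which a net $(\tau_i)$ converges to $\tau$ if and only if $\limsup\tau_i((a-\epsilon)_+)\le\tau(a)\le\liminf\tau_i(a)$ for all $a\in A_+$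 and $\epsilon>0$. Let $\tau_I\in\mathrm{T}(A)$ be the trace that is $0$ on $I_+$ and $\infty$ on $A_+\setminus I$, and put $$\mathrm{T}_I(A)=\bigl\{\tau\in\mathrm{T}(A) : \sup\{e\in\mathrm{T}(A) : e+e=e,\ e\le\tau\}=\tau_I\bigr\}.$$ Each of (i), (ii), (iii) implies: (iv) $\mathrm{T}_I(A)$ is a subcone of $\mathrm{T}(A)$ with neutral element $\tau_I$ (it contains $\tau_I$, is closed under addition and under multiplication by positive real numbers, and $\tau+\tau_I=\tau$ for all $\tau\in\mathrm{T}_I(A)$); it is cancellative and locally compact; and it has a compact base. More precisely, $\mathrm{Ped}(I)$ contains a full positive element, and for every full positive element $e\in\mathrm{Ped}(I)$ the set $T_e(A)=\{\tau\in\mathrm{T}_I(A) : \tau(e)=1\}$ is a compact base of $\mathrm{T}_I(A)$: it is a compact convex subset of $\mathrm{T}_I(A)$, $\tau_I\notin T_e(A)$, and each $\tau\in\mathrm{T}_I(A)$ with $\tau\ne\tau_I$ can be written in exactly one way as $\tau=r\sigma$ with a real number $r>0$ and $\sigma\in T_e(A)$. -/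

import Mathlib

open scoped NNReal ENNReal

universe u

namespace CStarTrace

/-! ### Closed two-sided ideals and their lattice -/

section Ideals

variable (A : Type u) [NonUnitalCStarAlgebra A]

/-- A closed two-sided ideal of a C⋆-algebra: a norm-closed linear subspace that absorbs
multiplication from both sides. -/
structure ClosedIdeal extends Submodule ℂ A where
  mul_mem_left' : ∀ (x : A) {a : A}, a ∈ carrier → x * a ∈ carrier
  mul_mem_right' : ∀ (x : A) {a : A}, a ∈ carrier → a * x ∈ carrier
  isClosed' : IsClosed carrier

variable {A}

namespace ClosedIdeal

instance : SetLike (ClosedIdeal A) A where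
  coe I := I.carrier
  coe_injective I J h := by
    obtain ⟨⟨⟨⟨_, _⟩, _⟩, _⟩, _, _, _⟩ := I
    obtain ⟨⟨⟨⟨_, _⟩, _⟩, _⟩, _, _, _⟩ := J
    congr

/-- Closed ideals are ordered by inclusion. -/
instance : PartialOrder (ClosedIdeal A) := PartialOrder.ofSetLike (ClosedIdeal A) A

theorem isClosed (I : ClosedIdeal A) : IsClosed (I : Set A) := I.isClosed'

theorem mul_mem_left (I : ClosedIdeal A) (x : A) {a : A} (ha : a ∈ I) : x * a ∈ I :=
  I.mul_mem_left' x ha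

theorem mul_mem_right (I : ClosedIdeal A) (x : A) {a : A} (ha : a ∈ I) : a * x ∈ I :=
  I.mul_mem_right' x ha

instance : NonUnitalSubringClass (ClosedIdeal A) A where
  add_mem {I} _ _ ha hb := I.toSubmodule.add_mem ha hb
  zero_mem I := I.toSubmodule.zero_mem
  neg_mem {I} _ ha := I.toSubmodule.neg_mem ha
  mul_mem {I} a _ _ hb := I.mul_mem_left a hb

instance : SMulMemClass (ClosedIdeal A) ℂ A where
  smul_mem {I} r _ ha := I.toSubmodule.smul_mem r ha

/-- If `0 ≤ z⋆z ≤ y` and `y` lies in a closed ideal, then so does `z`. -/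
theorem mem_of_star_mul_self_le [PartialOrder A] [StarOrderedRing A] (I : ClosedIdeal A)
    {z y : A} (hzy : star z * z ≤ y) (hy : y ∈ I) : z ∈ I := by
  have hy0 : 0 ≤ y := (star_mul_self_nonneg z).trans hzy
  have hysa : IsSelfAdjoint y := IsSelfAdjoint.of_nonneg hy0
  -- functional calculus of `y` stays in `I`
  let S : NonUnitalStarSubalgebra ℝ A :=
    { carrier := {x | x ∈ I ∧ star x ∈ I}
      add_mem' := fun ha hb => ⟨add_mem ha.1 hb.1, by rw [star_add]; exact add_mem ha.2 hb.2⟩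
      zero_mem' := ⟨zero_mem I, by rw [star_zero]; exact zero_mem I⟩
      mul_mem' := fun {a b} ha hb =>
        ⟨I.mul_mem_left a hb.1, by rw [star_mul]; exact I.mul_mem_left _ ha.2⟩
      smul_mem' := fun c x hx => by
        refine ⟨?_, ?_⟩
        · have : c • x = (c : ℂ) • x := (Complex.coe_smul c x).symm
          rw [this]; exact SMulMemClass.smul_mem _ hx.1
        · have : star (c • x) = (c : ℂ) • star x := by
            rw [star_smul, star_trivial]; exact (Complex.coe_smul c (star x)).symm
          rw [this]; exact SMulMemClass.smul_mem _ hx.2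
      star_mem' := fun {x} hx => ⟨hx.2, by rw [star_star]; exact hx.1⟩ }
  have hS : IsClosed (S : Set A) :=
    I.isClosed.inter (I.isClosed.preimage (continuous_star (R := A)))
  have hyS : y ∈ S := ⟨hy, by rw [hysa.star_eq]; exact hy⟩
  have hcfc : ∀ f : ℝ → ℝ, cfcₙ f y ∈ I := fun f =>
    (NonUnitalStarAlgebra.elemental.le_of_mem hS hyS (cfcₙ_mem_elemental f y)).1
  rw [← SetLike.mem_coe, ← I.isClosed.closure_eq, Metric.mem_closure_iff]
  intro ε hε
  set δ : ℝ := ε ^ 2 / 4 with hδ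
  have hδ0 : 0 < δ := by positivity
  let f : ℝ → ℝ := fun t => min 1 (|t| / δ)
  have hf : Continuous f := by fun_prop
  have hf0 : f 0 = 0 := by simp [f]
  set v : A := cfcₙ f y with hv
  have hvsa : star v = v := (cfcₙ_predicate f y : IsSelfAdjoint v).star_eq
  refine ⟨z * v, I.mul_mem_left z (hcfc f), ?_⟩
  -- the compression `w ↦ (1 - v) w (1 - v)`
  let E : A → A := fun w => w - v * w - w * v + v * w * v
  have hE : ∀ c : A, E (star c * c) = star (c - c * v) * (c - c * v) := by
    intro c
    simp only [E, star_sub, star_mul, hvsa]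
    noncomm_ring
  have hpos : 0 ≤ E (star z * z) := by rw [hE]; exact star_mul_self_nonneg _
  have hle : E (star z * z) ≤ E y := by
    obtain ⟨c, hc⟩ := CStarAlgebra.nonneg_iff_eq_star_mul_self.mp (sub_nonneg.mpr hzy)
    have : E y - E (star z * z) = E (star c * c) := by
      rw [← hc]; simp only [E]; noncomm_ring
    rw [← sub_nonneg, this, hE]
    exact star_mul_self_nonneg _
  have hEy : E y = cfcₙ (fun t => t - f t * t - t * f t + f t * t * f t) y := by
    have hid : cfcₙ (fun t : ℝ => t) y = y := cfcₙ_id' ℝ y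
    have hc1 : cfcₙ (fun t => f t * t) y = v * y := by
      rw [cfcₙ_mul f (fun t => t) y (by fun_prop) hf0 (by fun_prop) rfl, hid]
    have hc2 : cfcₙ (fun t => t * f t) y = y * v := by
      rw [cfcₙ_mul (fun t => t) f y (by fun_prop) rfl (by fun_prop) hf0, hid]
    have hc3 : cfcₙ (fun t => f t * t * f t) y = v * y * v := by
      rw [cfcₙ_mul (fun t => f t * t) f y (by fun_prop) (by simp) (by fun_prop) hf0, hc1]
    rw [cfcₙ_add (fun t => t - f t * t - t * f t) (fun t => f t * t * f t) y
        (by fun_prop) (by simp) (by fun_prop) (by simp),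
      cfcₙ_sub (fun t => t - f t * t) (fun t => t * f t) y
        (by fun_prop) (by simp) (by fun_prop) (by simp),
      cfcₙ_sub (fun t => t) (fun t => f t * t) y
        (by fun_prop) rfl (by fun_prop) (by simp), hid, hc1, hc2, hc3]
  have hnorm : ‖E y‖ ≤ δ := by
    rw [hEy]
    refine norm_cfcₙ_le fun t _ => ?_
    have h1 : t - f t * t - t * f t + f t * t * f t = t * (1 - f t) ^ 2 := by ring
    rw [h1, norm_mul, norm_pow, Real.norm_eq_abs, Real.norm_eq_abs, sq_abs]
    rcases le_total 1 (|t| / δ) with h | h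
    · have : f t = 1 := min_eq_left h
      rw [this]; simp; exact hδ0.le
    · have hft : f t = |t| / δ := min_eq_right h
      have ht : |t| ≤ δ := by rwa [div_le_one hδ0] at h
      have h0 : 0 ≤ f t := by rw [hft]; positivity
      have h1' : f t ≤ 1 := by rw [hft]; exact h
      have hsq : (1 - f t) ^ 2 ≤ 1 := by nlinarith
      calc |t| * (1 - f t) ^ 2 ≤ δ * 1 := by gcongr
        _ = δ := mul_one δ
  have hfin : ‖z - z * v‖ * ‖z - z * v‖ ≤ δ := by
    rw [← CStarRing.norm_star_mul_self, ← hE]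
    exact (CStarAlgebra.norm_le_norm_of_nonneg_of_le hpos hle).trans hnorm
  rw [dist_eq_norm]
  by_contra hcon
  push Not at hcon
  nlinarith [norm_nonneg (z - z * v)]

/-- Closed two-sided ideals of a C⋆-algebra are self-adjoint. -/
instance : StarMemClass (ClosedIdeal A) A where
  star_mem {I} x hx := by
    let _ := CStarAlgebra.spectralOrder A
    let _ := CStarAlgebra.spectralOrderedRing A
    refine I.mem_of_star_mul_self_le (z := star x) le_rfl ?_
    rw [star_star]
    exact I.mul_mem_right _ hx

instance (I : ClosedIdeal A) : IsClosed (I : Set A) := I.isClosed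

/-- A closed two-sided ideal, regarded as a C⋆-algebra in its own right. -/
noncomputable instance (I : ClosedIdeal A) : NonUnitalCStarAlgebra I :=
  NonUnitalStarSubalgebra.nonUnitalCStarAlgebra I

theorem mem_of_nonneg_of_le [PartialOrder A] [StarOrderedRing A] (I : ClosedIdeal A)
    {a b : A} (ha : 0 ≤ a) (hab : a ≤ b) (hb : b ∈ I) : a ∈ I := by
  obtain ⟨c, rfl⟩ := CStarAlgebra.nonneg_iff_eq_star_mul_self.mp ha
  exact I.mul_mem_left _ (I.mem_of_star_mul_self_le hab hb)

theorem star_mul_self_mem_iff [PartialOrder A] [StarOrderedRing A] (I : ClosedIdeal A)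
    {x : A} : star x * x ∈ I ↔ x ∈ I :=
  ⟨fun h => I.mem_of_star_mul_self_le le_rfl h, fun h => I.mul_mem_left _ h⟩

instance : InfSet (ClosedIdeal A) where
  sInf s :=
    { carrier := ⋂ I ∈ s, (I : Set A)
      add_mem' := fun ha hb => by
        simp only [Set.mem_iInter, SetLike.mem_coe] at *
        exact fun I hI => add_mem (ha I hI) (hb I hI)
      zero_mem' := by
        simp only [Set.mem_iInter, SetLike.mem_coe]
        exact fun I _ => zero_mem I
      smul_mem' := fun c x hx => by
        simp only [Set.mem_iInter, SetLike.mem_coe] at *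
        exact fun I hI => SMulMemClass.smul_mem c (hx I hI)
      mul_mem_left' := fun x a ha => by
        simp only [Set.mem_iInter, SetLike.mem_coe] at *
        exact fun I hI => I.mul_mem_left x (ha I hI)
      mul_mem_right' := fun x a ha => by
        simp only [Set.mem_iInter, SetLike.mem_coe] at *
        exact fun I hI => I.mul_mem_right x (ha I hI)
      isClosed' := isClosed_biInter fun I _ => I.isClosed }

theorem mem_sInf {s : Set (ClosedIdeal A)} {a : A} : a ∈ sInf s ↔ ∀ I ∈ s, a ∈ I := by
  change a ∈ (⋂ I ∈ s, (I : Set A)) ↔ _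
  simp

/-- `Lat(A)`: the complete lattice of closed two-sided ideals, ordered by inclusion. -/
instance : CompleteLattice (ClosedIdeal A) :=
  completeLatticeOfInf _ fun _ =>
    ⟨fun I hI _ ha => mem_sInf.mp ha I hI,
      fun _ hJ _ ha => mem_sInf.mpr fun _ hI => hJ hI ha⟩

/-- The closed two-sided ideal generated by a set. -/
def span (s : Set A) : ClosedIdeal A := sInf {I | s ⊆ I}

/-- A closed ideal is singly generated if it is the closed two-sided ideal generated by one
element. -/
def IsSinglyGenerated (I : ClosedIdeal A) : Prop := ∃ a : A, I = span {a}

end ClosedIdeal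

/-- An element of a C⋆-algebra is full if it generates it as a closed two-sided ideal. -/
def IsFull (a : A) : Prop := ClosedIdeal.span {a} = ⊤

/-! ### The Pedersen ideal -/

/-- A linear subspace which is a (not necessarily closed) two-sided ideal. -/
def IsTwoSidedIdeal (J : Submodule ℂ A) : Prop :=
  ∀ x : A, ∀ a ∈ J, x * a ∈ J ∧ a * x ∈ J

variable (A) in
/-- The Pedersen ideal: the smallest dense two-sided ideal, that is, the intersection of all dense
two-sided ideals. -/
def pedersenIdeal : Submodule ℂ A :=
  sInf {J | IsTwoSidedIdeal J ∧ Dense (J : Set A)}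

/-! ### The primitive ideal space -/

/-- A ⋆-representation on a Hilbert space is irreducible if it is nonzero and has no closed
invariant subspaces other than `0` and the whole space. -/
def IsIrreducibleRep {H : Type u} [NormedAddCommGroup H] [InnerProductSpace ℂ H] [CompleteSpace H]
    (π : A →⋆ₙₐ[ℂ] (H →L[ℂ] H)) : Prop :=
  (∃ a, π a ≠ 0) ∧
    ∀ K : Submodule ℂ H, IsClosed (K : Set H) → (∀ a, ∀ ξ ∈ K, π a ξ ∈ K) → K = ⊥ ∨ K = ⊤

/-- A primitive ideal is the kernel of an irreducible ⋆-representation. -/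
def ClosedIdeal.IsPrimitive (P : ClosedIdeal A) : Prop :=
  ∃ (H : Type u) (_ : NormedAddCommGroup H) (_ : InnerProductSpace ℂ H) (_ : CompleteSpace H)
    (π : A →⋆ₙₐ[ℂ] (H →L[ℂ] H)), IsIrreducibleRep π ∧ ∀ a, a ∈ P ↔ π a = 0

variable (A) in
/-- `Prim(A)`, the set of primitive ideals of `A`. -/
def Prim : Type u := {P : ClosedIdeal A // P.IsPrimitive}

/-- The hull-kernel (Jacobson) topology on `Prim(A)`: the closed sets are the hulls
`{P | K ⊆ P}` of the closed ideals `K`. -/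
instance : TopologicalSpace (Prim A) :=
  TopologicalSpace.generateFrom {U | ∃ K : ClosedIdeal A, U = {P : Prim A | K ≤ P.1}ᶜ}

end Ideals

/-! ### Lower-semicontinuous traces -/

section Traces

variable (A : Type u) [NonUnitalCStarAlgebra A] [PartialOrder A] [StarOrderedRing A]

/-- The cone `A₊` of positive elements. -/
abbrev Pos : Type u := {a : A // 0 ≤ a}

/-- `T(A)`: lower-semicontinuous traces `A₊ → [0, ∞]`. -/
structure Trace where
  toFun : Pos A → ℝ≥0∞
  map_zero' : toFun 0 = 0
  map_add' : ∀ a b, toFun (a + b) = toFun a + toFun b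
  map_smul' : ∀ (r : ℝ≥0) (a : Pos A), 0 < r →
    toFun ⟨(r : ℝ) • a.1, smul_nonneg r.2 a.2⟩ = r * toFun a
  map_mul_star' : ∀ x : A,
    toFun ⟨x * star x, mul_star_self_nonneg x⟩ = toFun ⟨star x * x, star_mul_self_nonneg x⟩
  lsc' : LowerSemicontinuous toFun

variable {A}

namespace Trace

instance : FunLike (Trace A) (Pos A) ℝ≥0∞ where
  coe := toFun
  coe_injective σ τ h := by cases σ; cases τ; congr

@[ext] theorem ext {σ τ : Trace A} (h : ∀ a, σ a = τ a) : σ = τ := DFunLike.ext _ _ h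

/-- The pointwise order. -/
instance : PartialOrder (Trace A) := PartialOrder.lift (fun τ : Trace A => (τ : Pos A → ℝ≥0∞))
  DFunLike.coe_injective

/-- The zero trace. -/
instance : Zero (Trace A) where
  zero :=
    { toFun := fun _ => 0
      map_zero' := rfl
      map_add' := by simp
      map_smul' := by simp
      map_mul_star' := by simp
      lsc' := lowerSemicontinuous_const }

/-- Pointwise addition. -/
instance : Add (Trace A) where
  add σ τ :=
    { toFun := fun a => σ a + τ a
      map_zero' := by
        change σ.toFun 0 + τ.toFun 0 = 0
        rw [σ.map_zero', τ.map_zero', add_zero]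
      map_add' := fun a b => by
        change σ.toFun (a + b) + τ.toFun (a + b) = _
        rw [σ.map_add', τ.map_add']
        exact add_add_add_comm _ _ _ _
      map_smul' := fun r a hr => by
        change σ.toFun _ + τ.toFun _ = _
        rw [σ.map_smul' r a hr, τ.map_smul' r a hr]
        exact (mul_add _ _ _).symm
      map_mul_star' := fun x => by
        change σ.toFun _ + τ.toFun _ = _
        rw [σ.map_mul_star', τ.map_mul_star']
        rfl
      lsc' := σ.lsc'.add τ.lsc' }

/-- Pointwise multiplication by nonnegative scalars (with `0 * ∞ = 0`). -/
noncomputable instance : SMul ℝ≥0 (Trace A) where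
  smul c τ :=
    { toFun := fun a => (c : ℝ≥0∞) * τ a
      map_zero' := by
        change (c : ℝ≥0∞) * τ.toFun 0 = 0
        rw [τ.map_zero', mul_zero]
      map_add' := fun a b => by
        change (c : ℝ≥0∞) * τ.toFun (a + b) = _
        rw [τ.map_add']
        exact mul_add _ _ _
      map_smul' := fun r a hr => by
        change (c : ℝ≥0∞) * τ.toFun _ = _
        rw [τ.map_smul' r a hr]
        exact mul_left_comm _ _ _
      map_mul_star' := fun x => by
        change (c : ℝ≥0∞) * τ.toFun _ = _
        rw [τ.map_mul_star']
        rfl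
      lsc' := (ENNReal.continuous_const_mul ENNReal.coe_ne_top).comp_lowerSemicontinuous τ.lsc'
        fun _ _ h => mul_le_mul_right h _ }

@[simp] theorem zero_apply (a : Pos A) : (0 : Trace A) a = 0 := rfl

@[simp] theorem add_apply (σ τ : Trace A) (a : Pos A) : (σ + τ) a = σ a + τ a := rfl

@[simp] theorem smul_apply (c : ℝ≥0) (τ : Trace A) (a : Pos A) :
    (c • τ) a = (c : ℝ≥0∞) * τ a := rfl

noncomputable instance : AddCommMonoid (Trace A) where
  add_assoc _ _ _ := ext fun _ => add_assoc _ _ _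
  zero_add _ := ext fun _ => zero_add _
  add_zero _ := ext fun _ => add_zero _
  add_comm _ _ := ext fun _ => add_comm _ _
  nsmul := nsmulRec

noncomputable instance : Module ℝ≥0 (Trace A) where
  one_smul _ := ext fun _ => by simp
  mul_smul _ _ _ := ext fun _ => by simp [mul_assoc]
  smul_zero _ := ext fun _ => by simp
  smul_add _ _ _ := ext fun _ => by simp [mul_add]
  add_smul _ _ _ := ext fun _ => by simp [add_mul]
  zero_smul _ := ext fun _ => by simp

open Classical in
/-- The trace `τ_I`, which is `0` on `I₊` and `∞` elsewhere. -/
noncomputable def ofIdeal (I : ClosedIdeal A) : Trace A where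
  toFun a := if (a : A) ∈ I then 0 else ∞
  map_zero' := if_pos (zero_mem I)
  map_add' a b := by
    by_cases ha : (a : A) ∈ I
    · by_cases hb : (b : A) ∈ I
      · have : ((a + b : Pos A) : A) ∈ I := add_mem ha hb
        simp only [if_pos ha, if_pos hb, if_pos this, add_zero]
      · have : ((a + b : Pos A) : A) ∉ I := fun h =>
          hb (I.mem_of_nonneg_of_le b.2 (le_add_of_nonneg_left a.2) h)
        simp only [if_neg hb, if_neg this, add_top]
    · have : ((a + b : Pos A) : A) ∉ I := fun h =>
        ha (I.mem_of_nonneg_of_le a.2 (le_add_of_nonneg_right b.2) h)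
      simp only [if_neg ha, if_neg this, top_add]
  map_smul' r a hr := by
    have key : (r : ℝ) • (a : A) ∈ I ↔ (a : A) ∈ I := by
      rw [← Complex.coe_smul]
      refine ⟨fun h => ?_, fun h => SMulMemClass.smul_mem _ h⟩
      have h2 := SMulMemClass.smul_mem (((r : ℝ) : ℂ)⁻¹) h
      rwa [inv_smul_smul₀ (by exact_mod_cast hr.ne')] at h2
    by_cases ha : (a : A) ∈ I
    · simp only [key, if_pos ha, mul_zero]
    · simp only [key, if_neg ha]
      exact (ENNReal.mul_top (by exact_mod_cast hr.ne')).symm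
  map_mul_star' x := by
    have key : x * star x ∈ I ↔ star x * x ∈ I := by
      rw [I.star_mul_self_mem_iff]
      have := I.star_mul_self_mem_iff (x := star x)
      rw [star_star] at this
      rw [this]
      exact ⟨fun h => by simpa using star_mem h, fun h => star_mem h⟩
    simp only [key]
  lsc' := by
    have hcl : IsClosed {a : Pos A | (a : A) ∈ I} := I.isClosed.preimage continuous_subtype_val
    intro a r hr
    by_cases ha : (a : A) ∈ I
    · simp only [if_pos ha] at hr
      exact absurd hr not_lt_zero
    · simp only [if_neg ha] at hr
      filter_upwards [hcl.isOpen_compl.mem_nhds ha] with b hb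
      have hb' : (b : A) ∉ I := hb
      simpa only [if_neg hb'] using hr

/-! ### The topology of `T(A)` -/

/-- The cut-down `(a - ε)₊` of a positive element, for `ε > 0`. -/
noncomputable def cutDown (a : Pos A) (ε : ℝ) : Pos A :=
  ⟨cfcₙ (fun t : ℝ => max 0 (t - ε)) a.1, cfcₙ_nonneg fun _ _ => le_max_left _ _⟩

/-- Convergence of a filter `F` on `T(A)` (equivalently, of a net in `T(A)`) to `τ`:
`limsup σ((a - ε)₊) ≤ τ(a) ≤ liminf σ(a)` along `F`, for every `a ∈ A₊` and every `ε > 0`. -/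
def ConvergesTo (F : Filter (Trace A)) (τ : Trace A) : Prop :=
  ∀ (a : Pos A) (ε : ℝ), 0 < ε →
    Filter.limsup (fun σ : Trace A => σ (cutDown a ε)) F ≤ τ a ∧
      τ a ≤ Filter.liminf (fun σ : Trace A => σ a) F

/-- The topology on `T(A)` in which a net converges precisely in the sense of `ConvergesTo`:
a set is open if and only if it belongs to every filter that converges to one of its points. -/
instance : TopologicalSpace (Trace A) where
  IsOpen U := ∀ τ ∈ U, ∀ F : Filter (Trace A), ConvergesTo F τ → U ∈ F
  isOpen_univ := fun _ _ _ _ => Filter.univ_mem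
  isOpen_inter := fun _ _ hU hV τ hτ F hF =>
    Filter.inter_mem (hU τ hτ.1 F hF) (hV τ hτ.2 F hF)
  isOpen_sUnion := fun _ hs τ ⟨U, hU, hτ⟩ F hF =>
    Filter.mem_of_superset (hs U hU τ hτ F hF) (Set.subset_sUnion_of_mem hU)

theorem mono (τ : Trace A) {a b : Pos A} (h : (a : A) ≤ b) : τ a ≤ τ b := by
  have hb : b = a + ⟨(b : A) - a, sub_nonneg.mpr h⟩ := by
    apply Subtype.ext
    change (b : A) = a + (b - a)
    abel
  rw [hb]
  change τ.toFun a ≤ τ.toFun _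
  rw [τ.map_add']
  exact le_self_add

theorem cutDown_cutDown (a : Pos A) {s t : ℝ} (hs : 0 ≤ s) (ht : 0 ≤ t) :
    cutDown (cutDown a s) t = cutDown a (s + t) := by
  apply Subtype.ext
  have ha : IsSelfAdjoint (a : A) := IsSelfAdjoint.of_nonneg a.2
  change cfcₙ _ (cfcₙ _ (a : A)) = cfcₙ _ (a : A)
  rw [← cfcₙ_comp' (fun x : ℝ => max 0 (x - t)) (fun x : ℝ => max 0 (x - s)) (a : A)
    (by fun_prop) (by simp [ht]) (by fun_prop) (by simp [hs])]
  congr 1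
  funext x
  rcases max_cases 0 (x - s) with h | h <;> rcases max_cases 0 (x - (s + t)) with h' | h' <;>
    rw [h.1, h'.1] <;> first
      | (apply max_eq_left; linarith)
      | (rw [max_eq_right] <;> linarith)

theorem cutDown_le (a : Pos A) {s t : ℝ} (hs : 0 ≤ s) (hst : s ≤ t) :
    (cutDown a t : A) ≤ cutDown a s :=
  cfcₙ_mono (fun x _ => max_le_max le_rfl (by linarith))
    (by fun_prop) (by fun_prop) (by simp [hs.trans hst]) (by simp [hs])

theorem cutDown_zero (a : Pos A) : cutDown a 0 = a := by
  apply Subtype.ext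
  have ha : IsSelfAdjoint (a : A) := IsSelfAdjoint.of_nonneg a.2
  change cfcₙ _ (a : A) = a
  conv_rhs => rw [← cfcₙ_id' ℝ (a : A)]
  refine cfcₙ_congr fun x hx => ?_
  have : 0 ≤ x := quasispectrum_nonneg_of_nonneg (a : A) a.2 x hx
  simp [this]

/-- Convergence in the topology of `T(A)` is exactly `ConvergesTo`. -/
theorem le_nhds_iff (F : Filter (Trace A)) (τ : Trace A) : F ≤ nhds τ ↔ ConvergesTo F τ := by
  constructor
  · intro hF a ε hε
    constructor
    · refine le_of_forall_gt_imp_ge_of_dense fun r hr => ?_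
      have hO : IsOpen {σ : Trace A | ∃ t, 0 ≤ t ∧ t < ε ∧ σ (cutDown a t) < r} := by
        rintro ρ ⟨t, ht0, ht, hρ⟩ G hG
        have h := (hG (cutDown a t) ((ε - t) / 2) (by linarith)).1.trans_lt hρ
        filter_upwards [Filter.eventually_lt_of_limsup_lt h] with σ hσ
        rw [cutDown_cutDown a ht0 (by linarith)] at hσ
        exact ⟨_, by linarith, by linarith, hσ⟩
      have hm := hF (hO.mem_nhds ⟨0, le_rfl, hε, by rwa [cutDown_zero]⟩)
      refine Filter.limsup_le_of_le (by isBoundedDefault) ?_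
      filter_upwards [hm] with σ hσ
      obtain ⟨t, ht0, ht, hσ⟩ := hσ
      exact (σ.mono (cutDown_le a ht0 ht.le)).trans hσ.le
    · refine le_of_forall_lt_imp_le_of_dense fun r hr => ?_
      have hO : IsOpen {σ : Trace A | r < σ a} := by
        intro ρ hρ G hG
        exact Filter.eventually_lt_of_lt_liminf (lt_of_lt_of_le hρ (hG a 1 one_pos).2)
      refine Filter.le_liminf_of_le (by isBoundedDefault) ?_
      filter_upwards [hF (hO.mem_nhds hr)] with σ hσ
      exact le_of_lt hσ
  · intro h U hU
    obtain ⟨V, hVU, hV, hτ⟩ := mem_nhds_iff.mp hU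
    exact Filter.mem_of_superset (hV τ hτ F h) hVU

/-! ### The subcones `T_I(A)` and their bases -/

/-- `T_I(A)`: the lower-semicontinuous traces whose support idempotent
`ε(τ) = sup {e ∈ T(A) | 2e = e ≤ τ}` is `τ_I`. -/
def supportedOn (I : ClosedIdeal A) : Set (Trace A) :=
  {τ | IsLUB {e : Trace A | e + e = e ∧ e ≤ τ} (ofIdeal I)}

/-- `C` is a subcone of `T(A)` with neutral element `z`: it is closed under addition and under
multiplication by positive scalars, it contains `z`, and `z` is neutral for its addition. -/
structure IsSubcone (C : Set (Trace A)) (z : Trace A) : Prop where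
  add_mem : ∀ σ ∈ C, ∀ τ ∈ C, σ + τ ∈ C
  smul_mem : ∀ r : ℝ≥0, 0 < r → ∀ τ ∈ C, r • τ ∈ C
  neutral_mem : z ∈ C
  add_neutral : ∀ τ ∈ C, τ + z = τ

/-- The addition of `C` is cancellative. -/
def IsCancellative (C : Set (Trace A)) : Prop :=
  ∀ ρ ∈ C, ∀ σ ∈ C, ∀ τ ∈ C, σ + ρ = τ + ρ → σ = τ

/-- `T` is a compact base of the cone `C` with neutral element `z`: a compact convex subset
of `C` not containing `z`, such that every element of `C` other than `z` is a positive multiple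
of an element of `T` in exactly one way. -/
structure IsCompactBase (C : Set (Trace A)) (z : Trace A) (T : Set (Trace A)) : Prop where
  subset : T ⊆ C
  isCompact : IsCompact T
  convex : Convex ℝ≥0 T
  neutral_notMem : z ∉ T
  existsUnique : ∀ τ ∈ C, τ ≠ z → ∃! p : ℝ≥0 × Trace A, 0 < p.1 ∧ p.2 ∈ T ∧ p.1 • p.2 = τ

/-- `T_e(A)`: the traces in `T_I(A)` with value `1` at `e`. -/
def normalizedAt (I : ClosedIdeal A) (e : Pos A) : Set (Trace A) :=
  {τ | τ ∈ supportedOn I ∧ τ e = 1}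

end Trace

end Traces

end CStarTrace

/-!
Call a set `C` of positive elements an invariant order ideal if it is closed under sums, contains
everything below its elements, and contains `xx⋆` whenever it contains `x⋆x`. Then
`J = {x | x⋆x ∈ C}` is a two-sided ideal. If a closed ideal `I` lies in the closure of `J`, then `C`
contains every cut-down `(a - ε)₊` with `a ∈ I₊`, and since the span of these cut-downs is an ideal
that is dense in `I`, `C` contains the positive part of `Ped(I)`. This applies to the set where a
trace is finite, to the set of elements dominated uniformly over all traces by a multiple of a
given one, and to the set where two comparable traces agree and are finite.

For compactness of `Prim(I)`: a positive functional vanishing on a closed ideal can be chosen to be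
a pure state, by Hahn–Banach and Krein–Milman, and its GNS representation is irreducible, so closed
ideals are intersections of primitive ideals and correspond to the open subsets of `Prim(I)`.

For compactness of sets of traces: the pointwise limit of an ultrafilter of traces is additive and
tracial but need not be lower semicontinuous. Its regularization `a ↦ sup_ε f((a - ε)₊)` is a
lower semicontinuous trace, is the limit in `T(A)`, and agrees with `f` on `Ped(I)` as soon as `f`
is finite on the cut-downs of `I₊`.
-/

namespace CStarTrace

/-! ### Closed ideals and closures of ideals -/

section Ideals

variable {A : Type u} [NonUnitalCStarAlgebra A]

namespace ClosedIdeal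

theorem real_smul_mem (I : ClosedIdeal A) (r : ℝ) {x : A} (hx : x ∈ I) : r • x ∈ I := by
  rw [← Complex.coe_smul]
  exact SMulMemClass.smul_mem _ hx

theorem mem_of_star_mul_self_mem (I : ClosedIdeal A) {x : A} (h : star x * x ∈ I) : x ∈ I := by
  let _ := CStarAlgebra.spectralOrder A
  let _ := CStarAlgebra.spectralOrderedRing A
  exact I.star_mul_self_mem_iff.mp h

theorem mem_top (a : A) : a ∈ (⊤ : ClosedIdeal A) := by
  rw [← sInf_empty]
  exact mem_sInf.mpr fun _ h => h.elim

theorem span_singleton_le_iff {a : A} {I : ClosedIdeal A} : span {a} ≤ I ↔ a ∈ I :=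
  ⟨fun h => h (mem_sInf.mpr fun _ hJ => hJ rfl), fun h => sInf_le (Set.singleton_subset_iff.mpr h)⟩

theorem mem_span_singleton_self (a : A) : a ∈ span {a} :=
  span_singleton_le_iff.mp le_rfl

theorem span_star_mul_self (a : A) : span {star a * a} = span {a} :=
  le_antisymm (span_singleton_le_iff.mpr ((span {a}).mul_mem_left _ (mem_span_singleton_self a)))
    (span_singleton_le_iff.mpr
      ((span {star a * a}).mem_of_star_mul_self_mem (mem_span_singleton_self _)))

end ClosedIdeal

namespace IsTwoSidedIdeal

/-- The norm closure of a two-sided ideal, as a closed ideal. -/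
def closure {J : Submodule ℂ A} (hJ : IsTwoSidedIdeal J) : ClosedIdeal A where
  toSubmodule := J.topologicalClosure
  mul_mem_left' x _ ha := map_mem_closure (continuous_const_mul x) ha fun b hb => (hJ x b hb).1
  mul_mem_right' x _ ha := map_mem_closure (f := fun y : A => y * x) (continuous_mul_const x) ha
    fun b hb => (hJ x b hb).2
  isClosed' := isClosed_closure

theorem mem_closure {J : Submodule ℂ A} (hJ : IsTwoSidedIdeal J) {a : A} :
    a ∈ hJ.closure ↔ a ∈ _root_.closure (J : Set A) := Iff.rfl

theorem subset_closure {J : Submodule ℂ A} (hJ : IsTwoSidedIdeal J) {a : A} (ha : a ∈ J) :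
    a ∈ hJ.closure := _root_.subset_closure ha

theorem closure_le_iff {J : Submodule ℂ A} (hJ : IsTwoSidedIdeal J) {I : ClosedIdeal A} :
    hJ.closure ≤ I ↔ J ≤ I.toSubmodule :=
  ⟨fun h _ ha => h (hJ.subset_closure ha), fun h => closure_minimal h I.isClosed⟩

theorem sSup {S : Set (Submodule ℂ A)} (hS : ∀ J ∈ S, IsTwoSidedIdeal J) :
    IsTwoSidedIdeal (sSup S) := fun x _ ha =>
  ⟨(sSup_le fun J hJ b hb => (le_sSup hJ : J ≤ _) ((hS J hJ x b hb).1) :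
      SupSet.sSup S ≤ (SupSet.sSup S).comap (LinearMap.mulLeft ℂ x)) ha,
    (sSup_le fun J hJ b hb => (le_sSup hJ : J ≤ _) ((hS J hJ x b hb).2) :
      SupSet.sSup S ≤ (SupSet.sSup S).comap (LinearMap.mulRight ℂ x)) ha⟩

/-- For `x ∈ J` close to `g`, the element `1 - (g - x)` of the unitization is invertible and maps
`e` to `x * e`. -/
theorem mem_of_mul_eq_self {J : Submodule ℂ A} (hJ : IsTwoSidedIdeal J) {g e : A}
    (hg : g ∈ hJ.closure) (hge : g * e = e) : e ∈ J := by
  obtain ⟨x, hx, hgx⟩ := Metric.mem_closure_iff.mp hg 1 one_pos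
  have hnorm : ‖((g - x : A) : Unitization ℂ A)‖ < 1 := by
    rwa [Unitization.norm_inr, ← dist_eq_norm]
  obtain ⟨u, hu⟩ := isUnit_one_sub_of_norm_lt_one hnorm
  have hue : (u : Unitization ℂ A) * (e : Unitization ℂ A) = ((x * e : A) : Unitization ℂ A) := by
    rw [hu, sub_mul, one_mul, ← Unitization.inr_mul, sub_mul, hge, ← Unitization.inr_sub,
      sub_sub_cancel]
  have he : e = u⁻¹.val.fst • (x * e) + u⁻¹.val.snd * (x * e) := by
    simpa using congrArg (fun z : Unitization ℂ A => z.snd)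
      ((Units.eq_inv_mul_iff_mul_eq u).mpr hue)
  have hxe : x * e ∈ J := (hJ e x hx).2
  rw [he]
  exact J.add_mem (J.smul_mem _ hxe) (hJ _ _ hxe).1

theorem pedersenIdeal_le {J : Submodule ℂ A} (hJ : IsTwoSidedIdeal J) (hd : Dense (J : Set A)) :
    pedersenIdeal A ≤ J := sInf_le ⟨hJ, hd⟩

end IsTwoSidedIdeal

theorem mem_pedersenIdeal_of_mul_eq_self {g e : A} (hge : g * e = e) : e ∈ pedersenIdeal A :=
  Submodule.mem_sInf.mpr fun _ hJ => hJ.1.mem_of_mul_eq_self (hJ.1.mem_closure.mpr (hJ.2 g)) hge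

namespace ClosedIdeal

theorem isTwoSidedIdeal (I : ClosedIdeal A) : IsTwoSidedIdeal I.toSubmodule :=
  fun x _ ha => ⟨I.mul_mem_left x ha, I.mul_mem_right x ha⟩

theorem isTwoSidedIdeal_sSup (D : Set (ClosedIdeal A)) :
    IsTwoSidedIdeal (sSup (ClosedIdeal.toSubmodule '' D)) :=
  .sSup (Set.forall_mem_image.mpr fun I _ => I.isTwoSidedIdeal)

theorem sSup_le_closure (D : Set (ClosedIdeal A)) :
    sSup D ≤ (isTwoSidedIdeal_sSup D).closure :=
  sSup_le fun I hI _ ha => (isTwoSidedIdeal_sSup D).subset_closure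
    ((le_sSup (Set.mem_image_of_mem _ hI) : I.toSubmodule ≤ _) ha)

end ClosedIdeal

end Ideals

/-! ### Functional calculus of positive elements -/

section FunctionalCalculus

variable {A : Type u} [NonUnitalCStarAlgebra A]

theorem cfcₙ_mul_self_mul_cfcₙ {a : A} (ha : IsSelfAdjoint a) {f : ℝ → ℝ} (hf : Continuous f)
    (hf0 : f 0 = 0) : cfcₙ f a * a * cfcₙ f a = cfcₙ (fun t => f t * t * f t) a := by
  rw [cfcₙ_mul (fun t => f t * t) f a (by fun_prop) (mul_zero _) (by fun_prop) hf0,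
    cfcₙ_mul f (fun t => t) a (by fun_prop) hf0 (by fun_prop) rfl, cfcₙ_id' ℝ a]

theorem cfcₙ_mul_self_mul_cfcₙ_sub_smul {a : A} (ha : IsSelfAdjoint a) {f : ℝ → ℝ}
    (hf : Continuous f) (hf0 : f 0 = 0) (η : ℝ) :
    cfcₙ f a * a * cfcₙ f a - η • (cfcₙ f a * cfcₙ f a) =
      cfcₙ (fun t => f t * f t * (t - η)) a := by
  rw [cfcₙ_mul_self_mul_cfcₙ ha hf hf0, ← cfcₙ_mul f f a (by fun_prop) hf0 (by fun_prop) hf0,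
    ← cfcₙ_const_mul η (fun t => f t * f t) a (by fun_prop) (mul_eq_zero_of_left hf0 _),
    ← cfcₙ_sub (fun t => f t * t * f t) (fun t => η * (f t * f t)) a (by fun_prop)
      (mul_eq_zero_of_right _ hf0) (by fun_prop) (by rw [hf0, mul_zero, mul_zero])]
  congr 1
  funext t
  ring

/-- A positive contraction in the functional calculus of `a` that acts as a unit on all functions
of `a` vanishing on `[0, ε]`. -/
noncomputable def plateau (a : A) (ε : ℝ) : A := cfcₙ (fun t : ℝ => max 0 (min 1 (t / ε))) a

theorem plateau_mul_cfcₙ {a : A} {ε : ℝ} (hε : 0 < ε) {f : ℝ → ℝ} (hf : Continuous f)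
    (h : ∀ t, t ≤ ε → f t = 0) : plateau a ε * cfcₙ f a = cfcₙ f a := by
  rw [plateau, ← cfcₙ_mul (fun t : ℝ => max 0 (min 1 (t / ε))) f a (by fun_prop) (by simp)
    (by fun_prop) (h 0 hε.le)]
  congr 1
  funext t
  rcases le_total t ε with ht | ht
  · rw [h t ht, mul_zero]
  · rw [min_eq_left ((one_le_div hε).mpr ht), max_eq_right zero_le_one, one_mul]

/-- The square root of the cut-down `(a - ε)₊` of a positive element `a`. -/
noncomputable def sqrtCutDown (a : A) (ε : ℝ) : A :=
  cfcₙ (fun t : ℝ => √(max 0 (t - ε))) a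

theorem isSelfAdjoint_sqrtCutDown (a : A) (ε : ℝ) : IsSelfAdjoint (sqrtCutDown a ε) :=
  .cfcₙ

theorem plateau_mul_sqrtCutDown (a : A) {ε : ℝ} (hε : 0 < ε) :
    plateau a ε * sqrtCutDown a ε = sqrtCutDown a ε :=
  plateau_mul_cfcₙ hε (by fun_prop) fun t ht => by
    rw [max_eq_left (sub_nonpos.mpr ht), Real.sqrt_zero]

variable [PartialOrder A] [StarOrderedRing A]

theorem norm_cfcₙ_le_of_nonneg {a : A} (ha : 0 ≤ a) {f : ℝ → ℝ} {η : ℝ}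
    (h : ∀ t, 0 ≤ t → |f t| ≤ η) : ‖cfcₙ f a‖ ≤ η :=
  norm_cfcₙ_le fun t ht => h t (quasispectrum_nonneg_of_nonneg a ha t ht)

theorem conjugate_le_smul_of_norm_le {w r : A} (hw : IsSelfAdjoint w) (hr : IsSelfAdjoint r)
    {η : ℝ} (hη : ‖r‖ ≤ η) : w * r * w ≤ η • (w * w) := by
  have hww : 0 ≤ w * w := hw.mul_self_nonneg
  calc w * r * w = star w * r * w := by rw [hw.star_eq]
    _ ≤ ‖r‖ • (star w * w) := CStarAlgebra.star_left_conjugate_le_norm_smul hr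
    _ = ‖r‖ • (w * w) := by rw [hw.star_eq]
    _ ≤ η • (w * w) := by gcongr

theorem norm_mul_cfcₙ_sub_sq_le {x c : A} (hc : star c * c ≤ x) {f : ℝ → ℝ} (hf : Continuous f)
    (hf0 : f 0 = 0) {η : ℝ} (hη : ∀ t, 0 ≤ t → t * (1 - f t) ^ 2 ≤ η) :
    ‖c * cfcₙ f x - c‖ ^ 2 ≤ η := by
  have hx : 0 ≤ x := (star_mul_self_nonneg c).trans hc
  obtain ⟨d, hd⟩ := CStarAlgebra.nonneg_iff_eq_star_mul_self.mp (sub_nonneg.mpr hc)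
  set w := cfcₙ f x
  have hw : star w = w := IsSelfAdjoint.cfcₙ.star_eq
  have hsum : star (c * w - c) * (c * w - c) + star (d * w - d) * (d * w - d) =
      x - w * x - x * w + w * x * w := by
    rw [eq_add_of_sub_eq' hd]
    simp only [star_sub, star_mul, hw]
    noncomm_ring
  have hcfc : x - w * x - x * w + w * x * w = cfcₙ (fun t => t * (1 - f t) ^ 2) x := by
    have hfx : w * x = cfcₙ (fun t => f t * t) x := by
      rw [cfcₙ_mul f (fun t => t) x (by fun_prop) hf0 (by fun_prop) rfl, cfcₙ_id' ℝ x]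
    have hxf : x * w = cfcₙ (fun t => t * f t) x := by
      rw [cfcₙ_mul (fun t => t) f x (by fun_prop) rfl (by fun_prop) hf0, cfcₙ_id' ℝ x]
    rw [cfcₙ_mul_self_mul_cfcₙ (.of_nonneg hx) hf hf0, hfx, hxf]
    nth_rw 1 [← cfcₙ_id' ℝ x]
    rw [← cfcₙ_sub .., ← cfcₙ_sub .., ← cfcₙ_add ..]
    · congr 1
      funext t
      ring
  have hle : star (c * w - c) * (c * w - c) ≤ cfcₙ (fun t => t * (1 - f t) ^ 2) x := by
    rw [← hcfc, ← hsum]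
    exact le_add_of_nonneg_right (star_mul_self_nonneg _)
  rw [sq, ← CStarRing.norm_star_mul_self]
  refine (CStarAlgebra.norm_le_norm_of_nonneg_of_le (star_mul_self_nonneg _) hle).trans
    (norm_cfcₙ_le_of_nonneg hx fun t ht => ?_)
  rw [abs_of_nonneg (by positivity)]
  exact hη t ht

namespace Trace

theorem coe_cutDown (a : Pos A) (ε : ℝ) :
    (cutDown a ε : A) = cfcₙ (fun t : ℝ => max 0 (t - ε)) (a : A) := rfl

theorem norm_sub_cutDown_le (a : Pos A) {ε : ℝ} (hε : 0 ≤ ε) :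
    ‖(a : A) - cutDown a ε‖ ≤ ε := by
  have hsa : IsSelfAdjoint (a : A) := .of_nonneg a.2
  nth_rw 1 [← cfcₙ_id' ℝ (a : A)]
  rw [coe_cutDown, ← cfcₙ_sub (fun t => t) (fun t : ℝ => max 0 (t - ε)) (a : A) (by fun_prop) rfl
    (by fun_prop) (by simp [hε])]
  refine norm_cfcₙ_le_of_nonneg a.2 fun t ht => ?_
  rw [abs_le]
  rcases max_cases 0 (t - ε) with h | h <;> rw [h.1] <;> constructor <;> linarith

theorem cutDown_le_self (a : Pos A) {ε : ℝ} (hε : 0 ≤ ε) : (cutDown a ε : A) ≤ a := by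
  conv_rhs => rw [← cutDown_zero a]
  exact cutDown_le a le_rfl hε

theorem cutDown_mem (I : ClosedIdeal A) {a : Pos A} (ha : (a : A) ∈ I) (ε : ℝ) :
    (cutDown a ε : A) ∈ I := cfcₙ_mem _ ha

theorem mem_of_forall_cutDown_mem (I : ClosedIdeal A) {a : Pos A}
    (h : ∀ ε, 0 < ε → (cutDown a ε : A) ∈ I) : (a : A) ∈ I := by
  rw [← SetLike.mem_coe, ← I.isClosed.closure_eq, Metric.mem_closure_iff]
  intro ε hε
  refine ⟨_, h (ε / 2) (half_pos hε), ?_⟩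
  rw [dist_eq_norm]
  exact (norm_sub_cutDown_le a (half_pos hε).le).trans_lt (half_lt_self hε)

theorem plateau_mul_cutDown (a : Pos A) {ε : ℝ} (hε : 0 < ε) :
    plateau (a : A) ε * cutDown a ε = cutDown a ε :=
  plateau_mul_cfcₙ hε (by fun_prop) fun t ht => max_eq_left (sub_nonpos.mpr ht)

theorem cutDown_mem_pedersenIdeal (I : ClosedIdeal A) {a : Pos A} (ha : (a : A) ∈ I) {ε : ℝ}
    (hε : 0 < ε) : (⟨cutDown a ε, cutDown_mem I ha ε⟩ : I) ∈ pedersenIdeal I :=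
  mem_pedersenIdeal_of_mul_eq_self (g := ⟨plateau a ε, cfcₙ_mem _ ha⟩)
    (Subtype.ext (plateau_mul_cutDown a hε))

theorem sqrtCutDown_mul_self (a : Pos A) {ε : ℝ} (hε : 0 ≤ ε) :
    sqrtCutDown (a : A) ε * sqrtCutDown (a : A) ε = cutDown a ε := by
  rw [sqrtCutDown, ← cfcₙ_mul (fun t : ℝ => √(max 0 (t - ε))) (fun t : ℝ => √(max 0 (t - ε)))
    (a : A) (by fun_prop) (by simp [hε]) (by fun_prop) (by simp [hε]), coe_cutDown]
  congr 1
  funext t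
  exact Real.mul_self_sqrt (le_max_left _ _)

theorem sqrtCutDown_conjugate_sub (a : Pos A) {ε : ℝ} (hε : 0 ≤ ε) :
    sqrtCutDown (a : A) ε * a * sqrtCutDown (a : A) ε - ε • (cutDown a ε : A) =
      cutDown a ε * cutDown a ε := by
  rw [← sqrtCutDown_mul_self a hε, sqrtCutDown,
    cfcₙ_mul_self_mul_cfcₙ_sub_smul (.of_nonneg a.2) (by fun_prop) (by simp [hε]), ← sqrtCutDown,
    sqrtCutDown_mul_self a hε, coe_cutDown, ← cfcₙ_mul (fun t : ℝ => max 0 (t - ε))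
      (fun t : ℝ => max 0 (t - ε)) (a : A) (by fun_prop) (by simp [hε]) (by fun_prop)
      (by simp [hε])]
  congr 1
  funext t
  rw [Real.mul_self_sqrt (le_max_left _ _)]
  rcases max_cases 0 (t - ε) with h | h <;> rw [h.1]
  rw [zero_mul, zero_mul]

end Trace

end FunctionalCalculus

/-! ### Pure states vanishing on an ideal -/

section Separation

variable {A : Type u} [NonUnitalCStarAlgebra A] [PartialOrder A] [StarOrderedRing A]

/-- The closure of `A₊ + K`, the cone dual to the positive functionals vanishing on `K`. -/
noncomputable def ClosedIdeal.nonnegModulo (K : ClosedIdeal A) : ProperCone ℝ A :=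
  Submodule.closure (PointedCone.positive ℝ A ⊔ (K.toSubmodule.restrictScalars ℝ : PointedCone ℝ A))

theorem ClosedIdeal.mem_nonnegModulo_of_nonneg (K : ClosedIdeal A) {p : A} (hp : 0 ≤ p) :
    p ∈ K.nonnegModulo :=
  subset_closure (Submodule.mem_sup_left hp)

theorem ClosedIdeal.mem_nonnegModulo_of_mem (K : ClosedIdeal A) {k : A} (hk : k ∈ K) :
    k ∈ K.nonnegModulo :=
  subset_closure (Submodule.mem_sup_right hk)

theorem ClosedIdeal.exists_norm_add_le_of_neg_mem_nonnegModulo {K : ClosedIdeal A} {a : A}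
    (ha : IsSelfAdjoint a) (h : -a ∈ K.nonnegModulo) {ε : ℝ} (hε : 0 < ε) :
    ∃ p, 0 ≤ p ∧ ∃ k ∈ K, IsSelfAdjoint (a + p + k) ∧ ‖a + p + k‖ ≤ ε := by
  obtain ⟨x, hx, hax⟩ := Metric.mem_closure_iff.mp h ε hε
  obtain ⟨p, hp, k, hk, rfl⟩ := Submodule.mem_sup.mp hx
  have hpsa : IsSelfAdjoint p := .of_nonneg hp
  have hre : (realPart (a + p + k) : A) = a + p + realPart k := by
    rw [map_add, map_add, AddSubgroup.coe_add, AddSubgroup.coe_add, ha.coe_realPart,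
      hpsa.coe_realPart]
  refine ⟨p, hp, realPart k, ?_, hre ▸ (realPart (a + p + k)).2, ?_⟩
  · rw [realPart_apply_coe]
    exact K.real_smul_mem _ (add_mem hk (star_mem hk))
  · rw [dist_eq_norm, ← norm_neg, neg_sub, sub_neg_eq_add, add_comm, ← add_assoc] at hax
    exact hre ▸ (realPart.norm_le (a + p + k)).trans hax.le

open Trace in
theorem ClosedIdeal.mem_of_neg_mem_nonnegModulo (K : ClosedIdeal A) {a : A} (ha : 0 ≤ a)
    (h : -a ∈ K.nonnegModulo) : a ∈ K := by
  refine mem_of_forall_cutDown_mem K (a := ⟨a, ha⟩) fun ε hε => ?_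
  obtain ⟨p, hp, k, hk, hr, hrε⟩ := exists_norm_add_le_of_neg_mem_nonnegModulo (.of_nonneg ha) h hε
  set w := sqrtCutDown a ε
  set b : Pos A := cutDown ⟨a, ha⟩ ε
  have hb : IsSelfAdjoint (b : A) := .of_nonneg b.2
  have hle : (b : A) * b ≤ -(w * k * w) := by
    have hwrw : w * (a + p + k) * w ≤ ε • (w * w) :=
      conjugate_le_smul_of_norm_le (isSelfAdjoint_sqrtCutDown a ε) hr hrε
    have hwpw : 0 ≤ w * p * w := (isSelfAdjoint_sqrtCutDown a ε).conjugate_nonneg hp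
    rw [sqrtCutDown_mul_self ⟨a, ha⟩ hε.le] at hwrw
    rw [← sqrtCutDown_conjugate_sub ⟨a, ha⟩ hε.le, ← sub_nonneg]
    convert add_nonneg (sub_nonneg.mpr hwrw) hwpw using 1
    noncomm_ring
  have hmem : -(w * k * w) ∈ K := neg_mem (K.mul_mem_right _ (K.mul_mem_left _ hk))
  refine K.mem_of_star_mul_self_mem ?_
  rw [hb.star_eq]
  exact K.mem_of_nonneg_of_le hb.mul_self_nonneg hle hmem

theorem ClosedIdeal.exists_nonneg_dual (K : ClosedIdeal A) {a : A} (ha : 0 ≤ a) (haK : a ∉ K) :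
    ∃ f : StrongDual ℝ A, (∀ p, 0 ≤ p → 0 ≤ f p) ∧ (∀ k ∈ K, f k = 0) ∧ 0 < f a := by
  obtain ⟨f, hf, hfa⟩ := K.nonnegModulo.hyperplane_separation_point
    fun h => haK (K.mem_of_neg_mem_nonnegModulo ha h)
  refine ⟨f, fun p hp => hf p (K.mem_nonnegModulo_of_nonneg hp), fun k hk => ?_, ?_⟩
  · have hneg := hf (-k) (K.mem_nonnegModulo_of_mem (neg_mem hk))
    rw [map_neg] at hneg
    exact le_antisymm (neg_nonneg.mp hneg) (hf k (K.mem_nonnegModulo_of_mem hk))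
  · rwa [map_neg, neg_lt_zero] at hfa

end Separation

theorem exists_mem_extremePoints_apply_ne_zero {E : Type*} [AddCommGroup E] [Module ℝ E]
    [TopologicalSpace E] [T2Space E] [IsTopologicalAddGroup E] [ContinuousSMul ℝ E]
    [LocallyConvexSpace ℝ E] {F : Type*} [AddCommMonoid F] [Module ℝ F] [TopologicalSpace F]
    [T1Space F] {s : Set E} (hs : IsCompact s) (hconv : Convex ℝ s) (f : E →L[ℝ] F) {x : E}
    (hx : x ∈ s) (hfx : f x ≠ 0) : ∃ y ∈ s.extremePoints ℝ, f y ≠ 0 := by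
  by_contra! hcon
  rw [← closure_convexHull_extremePoints hs hconv] at hx
  have hker : Convex ℝ (f ⁻¹' {0}) := (convex_singleton (0 : F)).is_linear_preimage f.isLinear
  exact hfx (closure_minimal (convexHull_min hcon hker) (isClosed_singleton.preimage f.continuous)
    hx)

section States

open scoped ComplexOrder

variable {B : Type u} [CStarAlgebra B]

/-- The hermitian functional that agrees with `f` on the self-adjoint elements. -/
noncomputable def hermitianExtension (f : StrongDual ℝ B) : StrongDual ℂ B :=
  ((1 / 2 : ℝ) • (f + f.comp (starL' ℝ : B ≃L[ℝ] B).toContinuousLinearMap)).extendRCLike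

theorem hermitianExtension_apply_of_isSelfAdjoint (f : StrongDual ℝ B) {x : B}
    (hx : IsSelfAdjoint x) : hermitianExtension f x = (f x : ℝ) := by
  have hI : star (Complex.I • x) = -(Complex.I • x) := by
    rw [star_smul, hx.star_eq, Complex.star_def, Complex.conj_I, neg_smul]
  rw [hermitianExtension, StrongDual.extendRCLike_apply]
  simp [hI, hx.star_eq, ← two_mul]

theorem hermitianExtension_apply_eq_zero {f : StrongDual ℝ B} {K : ClosedIdeal B}
    (hf : ∀ k ∈ K, f k = 0) {k : B} (hk : k ∈ K) : hermitianExtension f k = 0 := by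
  have hIk : Complex.I • k ∈ K := SMulMemClass.smul_mem _ hk
  rw [hermitianExtension, StrongDual.extendRCLike_apply]
  simp [-star_smul, hf _ hk, hf _ (star_mem hk), hf _ hIk, hf _ (star_mem hIk)]

variable [PartialOrder B]

/-- The states of a unital C⋆-algebra that vanish on a closed ideal, in the weak-⋆ dual. -/
def ClosedIdeal.states (K : ClosedIdeal B) : Set (WeakDual ℂ B) :=
  {φ | (∀ x, 0 ≤ x → 0 ≤ φ x) ∧ φ 1 = 1 ∧ ∀ k ∈ K, φ k = 0}

theorem ClosedIdeal.convex_states (K : ClosedIdeal B) : Convex ℝ K.states := by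
  rintro φ ⟨hφ, hφ1, hφK⟩ ψ ⟨hψ, hψ1, hψK⟩ s t hs ht hst
  have happly : ∀ x, (s • φ + t • ψ) x = s • φ x + t • ψ x := fun _ => rfl
  refine ⟨fun x hx => ?_, ?_, fun k hk => ?_⟩ <;> rw [happly]
  · exact add_nonneg (smul_nonneg hs (hφ x hx)) (smul_nonneg ht (hψ x hx))
  · rw [hφ1, hψ1, ← add_smul, hst, one_smul]
  · rw [hφK k hk, hψK k hk, smul_zero, smul_zero, add_zero]

variable [StarOrderedRing B]

theorem norm_apply_le_of_nonneg {φ : WeakDual ℂ B} (hφ : ∀ x, 0 ≤ x → 0 ≤ φ x) (hφ1 : φ 1 = 1)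
    (x : B) : ‖φ x‖ ≤ 4 * ‖x‖ := by
  obtain ⟨y, hy0, hyx, hy⟩ := CStarAlgebra.exists_sum_four_nonneg x
  have hφy : ∀ i, ‖φ (y i)‖ ≤ ‖x‖ := fun i => by
    have h := (PositiveLinearMap.mk₀ (φ : B →ₗ[ℂ] ℂ) hφ).norm_apply_le_of_nonneg (y i) (hy0 i)
    have h1 : PositiveLinearMap.mk₀ (φ : B →ₗ[ℂ] ℂ) hφ 1 = 1 := hφ1
    rw [h1, norm_one, one_mul] at h
    exact h.trans (hyx i)
  calc ‖φ x‖ = ‖∑ i : Fin 4, φ (Complex.I ^ (i : ℕ) • y i)‖ := by rw [← map_sum, ← hy]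
    _ ≤ ∑ _i : Fin 4, ‖x‖ := norm_sum_le_of_le _ fun i _ => by
      rw [map_smul, norm_smul, norm_pow, Complex.norm_I, one_pow, one_mul]
      exact hφy i
    _ = 4 * ‖x‖ := by simp

theorem ClosedIdeal.isCompact_states (K : ClosedIdeal B) : IsCompact K.states := by
  refine WeakDual.isCompact_of_bounded_of_closed ?_ ?_
  · refine isBounded_iff_forall_norm_le.mpr ⟨4, fun φ hφ => ?_⟩
    exact ContinuousLinearMap.opNorm_le_bound _ (by norm_num)
      (norm_apply_le_of_nonneg hφ.1 hφ.2.1)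
  · have hstates : K.states = (⋂ (x : B) (_ : 0 ≤ x), {φ : WeakDual ℂ B | 0 ≤ φ x}) ∩
        ({φ | φ 1 = 1} ∩ ⋂ k ∈ K, {φ : WeakDual ℂ B | φ k = 0}) := by
      ext φ
      simp [states]
    rw [hstates]
    exact (isClosed_biInter fun x _ => isClosed_le continuous_const (WeakDual.eval_continuous x)
      ).inter ((isClosed_eq (WeakDual.eval_continuous 1) continuous_const).inter
        (isClosed_biInter fun k _ => isClosed_eq (WeakDual.eval_continuous k) continuous_const))

theorem apply_one_pos {f : StrongDual ℝ B} (hf : ∀ p, 0 ≤ p → 0 ≤ f p) {a : B} (ha : 0 ≤ a)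
    (hfa : 0 < f a) : 0 < f 1 := by
  have hle : a ≤ ‖a‖ • (1 : B) := by
    rw [← Algebra.algebraMap_eq_smul_one]
    exact IsSelfAdjoint.le_algebraMap_norm_self (.of_nonneg ha)
  have h := hf _ (sub_nonneg.mpr hle)
  rw [map_sub, map_smul, smul_eq_mul, sub_nonneg] at h
  exact pos_of_mul_pos_right (hfa.trans_le h) (norm_nonneg a)

theorem ClosedIdeal.exists_state (K : ClosedIdeal B) {a : B} (ha : 0 ≤ a) (haK : a ∉ K) :
    ∃ φ ∈ K.states, φ a ≠ 0 := by
  obtain ⟨f, hf, hfK, hfa⟩ := K.exists_nonneg_dual ha haK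
  have hf1 : 0 < f 1 := apply_one_pos hf ha hfa
  set φ : WeakDual ℂ B := hermitianExtension ((f 1)⁻¹ • f)
  have hφ : ∀ x, IsSelfAdjoint x → φ x = ((f 1)⁻¹ * f x : ℝ) := fun x =>
    hermitianExtension_apply_of_isSelfAdjoint ((f 1)⁻¹ • f)
  refine ⟨φ, ⟨fun x hx => ?_, ?_, fun k => ?_⟩, ?_⟩
  · rw [hφ x (.of_nonneg hx)]
    exact_mod_cast mul_nonneg (inv_nonneg.mpr hf1.le) (hf x hx)
  · rw [hφ 1 (.one B), inv_mul_cancel₀ hf1.ne', Complex.ofReal_one]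
  · exact hermitianExtension_apply_eq_zero fun l hl => mul_eq_zero_of_right _ (hfK l hl)
  · rw [hφ a (.of_nonneg ha)]
    exact_mod_cast (mul_pos (inv_pos.mpr hf1) hfa).ne'

theorem ClosedIdeal.exists_extreme_state (K : ClosedIdeal B) {a : B} (ha : 0 ≤ a) (haK : a ∉ K) :
    ∃ φ ∈ K.states.extremePoints ℝ, φ a ≠ 0 := by
  obtain ⟨φ, hφ, hφa⟩ := K.exists_state ha haK
  have : LocallyConvexSpace ℝ (WeakDual ℂ B) := WeakBilin.locallyConvexSpace
  let evalAt : WeakDual ℂ B →L[ℝ] ℂ :=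
    { toFun := fun ψ => ψ a
      map_add' := fun _ _ => rfl
      map_smul' := fun _ _ => rfl
      cont := WeakDual.eval_continuous a }
  have hext := exists_mem_extremePoints_apply_ne_zero (E := WeakDual ℂ B) K.isCompact_states
    (by exact K.convex_states) evalAt hφ hφa
  exact hext

end States

/-! ### Irreducibility of the GNS representation of a pure state -/

open scoped InnerProductSpace

section StarRepresentation

variable {H : Type*} [NormedAddCommGroup H] [InnerProductSpace ℂ H] [CompleteSpace H]
  {R : Type*} [NonUnitalSemiring R] [Module ℂ R] [StarRing R] {π : R →⋆ₙₐ[ℂ] (H →L[ℂ] H)}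
  {N : Submodule ℂ H}

theorem inner_map_star_left (π : R →⋆ₙₐ[ℂ] (H →L[ℂ] H)) (b : R) (x y : H) :
    ⟪π (star b) x, y⟫_ℂ = ⟪x, π b y⟫_ℂ := by
  rw [map_star, ContinuousLinearMap.star_eq_adjoint, ContinuousLinearMap.adjoint_inner_left]

theorem map_mem_orthogonal (hN : ∀ b, ∀ x ∈ N, π b x ∈ N) (b : R) {y : H} (hy : y ∈ Nᗮ) :
    π b y ∈ Nᗮ := by
  refine (Submodule.mem_orthogonal _ _).mpr fun x hx => ?_
  rw [← inner_map_star_left]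
  exact (Submodule.mem_orthogonal _ _).mp hy _ (hN _ x hx)

theorem starProjection_map_apply [N.HasOrthogonalProjection] (hN : ∀ b, ∀ x ∈ N, π b x ∈ N)
    (b : R) (x : H) : N.starProjection (π b x) = π b (N.starProjection x) := by
  refine Submodule.eq_starProjection_of_mem_orthogonal (hN b _ (N.starProjection_apply_mem x)) ?_
  rw [← map_sub]
  exact map_mem_orthogonal hN b (N.sub_starProjection_mem_orthogonal x)

theorem eq_bot_or_eq_top_of_starProjection_eq_smul [N.HasOrthogonalProjection]
    (hN : ∀ b, ∀ x ∈ N, π b x ∈ N) {ξ : H} (hξ : DenseRange fun b => π b ξ) {s : ℂ}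
    (hs : N.starProjection ξ = s • ξ) : N = ⊥ ∨ N = ⊤ := by
  have hP : ∀ x, N.starProjection x = s • x := by
    refine congrFun (hξ.equalizer (by fun_prop) (by fun_prop) (funext fun b => ?_))
    simp only [Function.comp_apply]
    rw [starProjection_map_apply hN, hs, map_smul]
  rcases eq_or_ne s 0 with rfl | hs0
  · refine .inl ((Submodule.eq_bot_iff _).mpr fun x hx => ?_)
    rw [← Submodule.starProjection_eq_self_iff.mpr hx, hP, zero_smul]
  · refine .inr (Submodule.eq_top_iff'.mpr fun x => ?_)
    rw [← inv_smul_smul₀ hs0 x, ← hP]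
    exact N.smul_mem _ (N.starProjection_apply_mem x)

end StarRepresentation

section VectorStates

open scoped ComplexOrder CStarAlgebra

variable {H : Type*} [NormedAddCommGroup H] [InnerProductSpace ℂ H] [CompleteSpace H]
  {B : Type u} [CStarAlgebra B] {π : B →⋆ₙₐ[ℂ] (H →L[ℂ] H)} {ξ : H} {K : ClosedIdeal B}

theorem map_one_apply (hξ : DenseRange fun b => π b ξ) (x : H) : π 1 x = x := by
  have h : (π 1 : H → H) = id := by
    refine hξ.equalizer (by fun_prop) continuous_id (funext fun b => ?_)
    simp only [Function.comp_apply, id_eq]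
    rw [← mul_apply_eq_comp, ← map_mul, one_mul]
  exact congrFun h x

theorem map_eq_zero_of_inner_eq_zero (hξ : DenseRange fun b => π b ξ)
    (hK : ∀ k ∈ K, ⟪ξ, π k ξ⟫_ℂ = 0) {k : B} (hk : k ∈ K) : π k = 0 := by
  suffices (π k : H → H) = fun _ => 0 from ContinuousLinearMap.ext (congrFun this)
  refine hξ.equalizer (by fun_prop) continuous_const (funext fun b => ?_)
  have hmem : star b * (star k * (k * b)) ∈ K :=
    K.mul_mem_left _ (K.mul_mem_left _ (K.mul_mem_right _ hk))
  have h := hK _ hmem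
  rwa [map_mul, mul_apply_eq_comp, ← inner_map_star_left, star_star, map_mul, mul_apply_eq_comp,
    ← inner_map_star_left, star_star, map_mul, mul_apply_eq_comp, inner_self_eq_zero] at h

/-- The functional `b ↦ ⟪x, π b x⟫` induced by a vector `x`. -/
noncomputable def vectorFunctional (π : B →⋆ₙₐ[ℂ] (H →L[ℂ] H)) (x : H) : WeakDual ℂ B :=
  { toFun := fun b => ⟪x, π b x⟫_ℂ
    map_add' := fun a b => by rw [map_add, add_apply, inner_add_right]
    map_smul' := fun c b => by rw [map_smul, smul_apply, inner_smul_right]; rfl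
    cont := by
      have : Continuous π := map_continuous π
      fun_prop }

theorem vectorFunctional_apply (x : H) (b : B) : vectorFunctional π x b = ⟪x, π b x⟫_ℂ := rfl

theorem vectorFunctional_add {N : Submodule ℂ H} (hN : ∀ b, ∀ x ∈ N, π b x ∈ N) {x y : H}
    (hx : x ∈ N) (hy : y ∈ Nᗮ) :
    vectorFunctional π (x + y) = vectorFunctional π x + vectorFunctional π y := by
  refine DFunLike.ext _ _ fun b => ?_
  have h₁ : ⟪x, π b y⟫_ℂ = 0 := Submodule.inner_right_of_mem_orthogonal hx
    (map_mem_orthogonal hN b hy)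
  have h₂ : ⟪y, π b x⟫_ℂ = 0 := Submodule.inner_left_of_mem_orthogonal (hN b x hx) hy
  change ⟪x + y, π b (x + y)⟫_ℂ = ⟪x, π b x⟫_ℂ + ⟪y, π b y⟫_ℂ
  rw [map_add, inner_add_left, inner_add_right, inner_add_right, h₁, h₂, add_zero, zero_add]

variable [PartialOrder B]

theorem norm_sq_eq_one_of_vectorFunctional_mem_states (hξ : DenseRange fun b => π b ξ)
    (h : vectorFunctional π ξ ∈ K.states) : ‖ξ‖ ^ 2 = 1 := by
  have h1 : ⟪ξ, π 1 ξ⟫_ℂ = 1 := h.2.1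
  rw [map_one_apply hξ, inner_self_eq_norm_sq_to_K, RCLike.ofReal_eq_complex_ofReal] at h1
  exact_mod_cast h1

variable [StarOrderedRing B]

theorem smul_vectorFunctional_mem_states (hπ : ∀ x, π 1 x = x) (hK : ∀ k ∈ K, π k = 0) {x : H}
    (hx : x ≠ 0) : (‖x‖ ^ 2)⁻¹ • vectorFunctional π x ∈ K.states := by
  have happly : ∀ b, ((‖x‖ ^ 2)⁻¹ • vectorFunctional π x) b = (‖x‖ ^ 2)⁻¹ • ⟪x, π b x⟫_ℂ :=
    fun _ => rfl
  refine ⟨fun b hb => ?_, ?_, fun k hk => ?_⟩ <;> rw [happly]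
  · obtain ⟨d, rfl⟩ := CStarAlgebra.nonneg_iff_eq_star_mul_self.mp hb
    rw [map_mul, mul_apply_eq_comp, ← inner_map_star_left, star_star]
    refine smul_nonneg (inv_nonneg.mpr (sq_nonneg _)) ?_
    rw [inner_self_eq_norm_sq_to_K, RCLike.ofReal_eq_complex_ofReal]
    exact_mod_cast sq_nonneg ‖π d x‖
  · rw [hπ, inner_self_eq_norm_sq_to_K, Complex.real_smul]
    have : (‖x‖ : ℂ) ≠ 0 := by exact_mod_cast norm_ne_zero_iff.mpr hx
    push_cast
    exact inv_mul_cancel₀ (pow_ne_zero 2 this)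
  · rw [hK k hk, zero_apply, inner_zero_right, smul_zero]

/-- Splitting `ξ` along an invariant subspace writes the vector state of `ξ` as a convex
combination of states. -/
theorem inner_map_apply_of_extreme (hξ : DenseRange fun b => π b ξ)
    (hext : vectorFunctional π ξ ∈ K.states.extremePoints ℝ) {N : Submodule ℂ H}
    (hN : ∀ b, ∀ x ∈ N, π b x ∈ N) {x y : H} (hx : x ∈ N) (hy : y ∈ Nᗮ) (hxy : x + y = ξ)
    (hx0 : x ≠ 0) (hy0 : y ≠ 0) (b : B) : ⟪x, π b x⟫_ℂ = ‖x‖ ^ 2 * ⟪ξ, π b ξ⟫_ℂ := by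
  have hπ : ∀ z, π 1 z = z := map_one_apply hξ
  have hK : ∀ k ∈ K, π k = 0 := fun k => map_eq_zero_of_inner_eq_zero hξ hext.1.2.2
  have hnorm : ‖x‖ ^ 2 + ‖y‖ ^ 2 = 1 := by
    rw [← norm_sq_eq_one_of_vectorFunctional_mem_states hξ hext.1, ← hxy, sq, sq, sq]
    exact (norm_add_sq_eq_norm_sq_add_norm_sq_of_inner_eq_zero (𝕜 := ℂ) x y
      (Submodule.inner_right_of_mem_orthogonal hx hy)).symm
  have hx2 : 0 < ‖x‖ ^ 2 := by positivity
  have hy2 : 0 < ‖y‖ ^ 2 := by positivity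
  have hsplit : (‖x‖ ^ 2) • ((‖x‖ ^ 2)⁻¹ • vectorFunctional π x) +
      (‖y‖ ^ 2) • ((‖y‖ ^ 2)⁻¹ • vectorFunctional π y) = vectorFunctional π ξ := by
    rw [← hxy, vectorFunctional_add hN hx hy]
    exact congrArg₂ (· + ·) (smul_inv_smul₀ hx2.ne' _) (smul_inv_smul₀ hy2.ne' _)
  have hxξ : (‖x‖ ^ 2)⁻¹ • vectorFunctional π x = vectorFunctional π ξ :=
    ((mem_extremePoints.mp hext).2 _ (smul_vectorFunctional_mem_states hπ hK hx0) _
      (smul_vectorFunctional_mem_states hπ hK hy0) ⟨_, _, hx2, hy2, hnorm, hsplit⟩).1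
  have hb : (‖x‖ ^ 2)⁻¹ • ⟪x, π b x⟫_ℂ = ⟪ξ, π b ξ⟫_ℂ := DFunLike.congr_fun hxξ b
  rw [← hb, ← Complex.ofReal_pow, ← Complex.real_smul, smul_inv_smul₀ hx2.ne']

theorem exists_starProjection_eq_smul_of_extreme (hξ : DenseRange fun b => π b ξ)
    (hext : vectorFunctional π ξ ∈ K.states.extremePoints ℝ) {N : Submodule ℂ H}
    [N.HasOrthogonalProjection] (hN : ∀ b, ∀ x ∈ N, π b x ∈ N) :
    ∃ s : ℂ, N.starProjection ξ = s • ξ := by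
  set x := N.starProjection ξ
  have hx : x ∈ N := N.starProjection_apply_mem ξ
  have hy : ξ - x ∈ Nᗮ := N.sub_starProjection_mem_orthogonal ξ
  have hxy : x + (ξ - x) = ξ := add_sub_cancel x ξ
  rcases eq_or_ne x 0 with hx0 | hx0
  · exact ⟨0, by rw [hx0, zero_smul]⟩
  rcases eq_or_ne (ξ - x) 0 with hy0 | hy0
  · exact ⟨1, by rw [one_smul, ← sub_eq_zero.mp hy0]⟩
  refine ⟨‖x‖ ^ 2, sub_eq_zero.mp (hξ.eq_zero_of_inner_left ℂ fun b => ?_)⟩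
  have hπx : ⟪x, π b ξ⟫_ℂ = ⟪x, π b x⟫_ℂ := by
    rw [← hxy, map_add, inner_add_right, Submodule.inner_right_of_mem_orthogonal hx
      (map_mem_orthogonal hN b hy), add_zero]
  rw [inner_sub_left, inner_smul_left, hπx, inner_map_apply_of_extreme hξ hext hN hx hy hxy hx0 hy0,
    map_pow, Complex.conj_ofReal, sub_self]

theorem isIrreducibleRep_of_extreme {H : Type u} [NormedAddCommGroup H] [InnerProductSpace ℂ H]
    [CompleteSpace H] {π : B →⋆ₙₐ[ℂ] (H →L[ℂ] H)} {ξ : H} (hξ : DenseRange fun b => π b ξ)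
    (hext : vectorFunctional π ξ ∈ K.states.extremePoints ℝ) : IsIrreducibleRep π := by
  refine ⟨⟨1, fun h => ?_⟩, fun N hN hinv => ?_⟩
  · have h1 : ⟪ξ, π 1 ξ⟫_ℂ = 1 := hext.1.2.1
    rw [h, zero_apply, inner_zero_right] at h1
    exact zero_ne_one h1
  · have : CompleteSpace N := hN.completeSpace_coe
    obtain ⟨s, hs⟩ := exists_starProjection_eq_smul_of_extreme hξ hext hinv
    exact eq_bot_or_eq_top_of_starProjection_eq_smul hinv hξ hs

theorem exists_rep (φ : WeakDual ℂ B) (hφ : ∀ x, 0 ≤ x → 0 ≤ φ x) :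
    ∃ (H : Type u) (_ : NormedAddCommGroup H) (_ : InnerProductSpace ℂ H) (_ : CompleteSpace H)
      (π : B →⋆ₙₐ[ℂ] (H →L[ℂ] H)) (ξ : H), (DenseRange fun b => π b ξ) ∧
        vectorFunctional π ξ = φ := by
  let f := PositiveLinearMap.mk₀ (φ : B →ₗ[ℂ] ℂ) hφ
  let ξ : f.GNS := ((f.toPreGNS 1 : f.PreGNS) : UniformSpace.Completion f.PreGNS)
  have hξ : ∀ b, f.gnsNonUnitalStarAlgHom b ξ =
      ((f.toPreGNS b : f.PreGNS) : UniformSpace.Completion f.PreGNS) := fun b => by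
    rw [PositiveLinearMap.gnsNonUnitalStarAlgHom_apply_coe]
    simp
  refine ⟨f.GNS, inferInstance, inferInstance, inferInstance, f.gnsNonUnitalStarAlgHom, ξ, ?_, ?_⟩
  · simp only [hξ]
    exact UniformSpace.Completion.denseRange_coe.comp f.toPreGNS.surjective.denseRange
      (UniformSpace.Completion.continuous_coe _)
  · refine DFunLike.ext _ _ fun b => ?_
    rw [vectorFunctional_apply, hξ, UniformSpace.Completion.inner_coe,
      PositiveLinearMap.preGNS_inner_def]
    simp only [PositiveLinearMap.ofPreGNS_toPreGNS, star_one, one_mul]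
    rfl

theorem ClosedIdeal.exists_isIrreducibleRep (K : ClosedIdeal B) {a : B} (ha : 0 ≤ a) (haK : a ∉ K) :
    ∃ (H : Type u) (_ : NormedAddCommGroup H) (_ : InnerProductSpace ℂ H) (_ : CompleteSpace H)
      (π : B →⋆ₙₐ[ℂ] (H →L[ℂ] H)), IsIrreducibleRep π ∧ (∀ k ∈ K, π k = 0) ∧ π a ≠ 0 := by
  obtain ⟨φ, hφ, hφa⟩ := K.exists_extreme_state ha haK
  obtain ⟨H, _, _, _, π, ξ, hξ, rfl⟩ := exists_rep φ hφ.1.1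
  refine ⟨H, _, _, _, π, isIrreducibleRep_of_extreme hξ hφ,
    fun k => map_eq_zero_of_inner_eq_zero hξ hφ.1.2.2, fun h => hφa ?_⟩
  rw [vectorFunctional_apply, h, zero_apply, inner_zero_right]

end VectorStates

/-! ### Closed ideals as intersections of primitive ideals -/

section Restriction

variable {A B : Type u} [NonUnitalCStarAlgebra A] [NonUnitalCStarAlgebra B]
  {H : Type u} [NormedAddCommGroup H] [InnerProductSpace ℂ H] [CompleteSpace H]
  {π : B →⋆ₙₐ[ℂ] (H →L[ℂ] H)} {ι : A →⋆ₙₐ[ℂ] B}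

theorem IsIrreducibleRep.eq_zero_of_forall_comp_apply_eq_zero (hπ : IsIrreducibleRep π)
    (hι : ∀ a b, ∃ a', ι a' = ι a * b) (hne : ∃ a, π (ι a) ≠ 0) {η : H}
    (hη : ∀ a, π (ι a) η = 0) : η = 0 := by
  let Z : Submodule ℂ H := ⨅ a, (π (ι a)).ker
  have hZ : ∀ {ζ}, ζ ∈ Z ↔ ∀ a, π (ι a) ζ = 0 := by simp [Z]
  have hclosed : IsClosed (Z : Set H) := by
    rw [Submodule.coe_iInf]
    exact isClosed_iInter fun a => (π (ι a)).isClosed_ker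
  have hinv : ∀ b, ∀ ζ ∈ Z, π b ζ ∈ Z := fun b ζ hζ => hZ.mpr fun a => by
    obtain ⟨a', ha'⟩ := hι a b
    rw [← mul_apply_eq_comp, ← map_mul, ← ha', hZ.mp hζ]
  have hbot : Z = ⊥ := (hπ.2 Z hclosed hinv).resolve_right fun htop => by
    obtain ⟨a, ha⟩ := hne
    exact ha (ContinuousLinearMap.ext fun ζ => hZ.mp (htop ▸ Submodule.mem_top) a)
  rw [← Submodule.mem_bot ℂ, ← hbot, hZ]
  exact hη

theorem map_mem_topologicalClosure_span (hι : ∀ b a, ∃ a', ι a' = b * ι a) (N : Submodule ℂ H)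
    (b : B) {ζ : H} (hζ : ζ ∈ (Submodule.span ℂ {π (ι a) η | (a : A) (η ∈ N)}).topologicalClosure) :
    π b ζ ∈ (Submodule.span ℂ {π (ι a) η | (a : A) (η ∈ N)}).topologicalClosure := by
  refine Submodule.topologicalClosure_mono ((Submodule.map_span_le (π b : H →ₗ[ℂ] H) _ _).mpr ?_)
    (Submodule.topologicalClosure_map (π b) _ (Submodule.mem_map_of_mem hζ))
  rintro _ ⟨a, η, hη, rfl⟩
  obtain ⟨a', ha'⟩ := hι b a
  refine Submodule.subset_span ⟨a', η, hη, ?_⟩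
  rw [ha', map_mul]
  rfl

/-- If `N` is invariant under the ideal, then the closure of `π(A) N` is invariant under `B`. -/
theorem IsIrreducibleRep.comp (hπ : IsIrreducibleRep π) (hl : ∀ b a, ∃ a', ι a' = b * ι a)
    (hr : ∀ a b, ∃ a', ι a' = ι a * b) (hne : ∃ a, π (ι a) ≠ 0) : IsIrreducibleRep (π.comp ι) := by
  refine ⟨hne, fun N hN hinv => ?_⟩
  rcases hπ.2 _ (Submodule.isClosed_topologicalClosure _)
    fun b ζ => map_mem_topologicalClosure_span hl N b with h | h
  · refine .inl ((Submodule.eq_bot_iff N).mpr fun η hη =>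
      hπ.eq_zero_of_forall_comp_apply_eq_zero hr hne fun a => ?_)
    rw [← Submodule.mem_bot ℂ, ← h]
    exact Submodule.le_topologicalClosure _ (Submodule.subset_span ⟨a, η, hη, rfl⟩)
  · refine .inr (top_le_iff.mp (h ▸ Submodule.topologicalClosure_minimal _ ?_ hN))
    rw [Submodule.span_le]
    rintro _ ⟨a, η, hη, rfl⟩
    exact hinv a η hη

end Restriction

section Primitive

open scoped CStarAlgebra

variable {A : Type u} [NonUnitalCStarAlgebra A]

theorem exists_inr_eq_mul_inr (b : Unitization ℂ A) (a : A) :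
    ∃ a' : A, (a' : Unitization ℂ A) = b * a :=
  ⟨b.fst • a + b.snd * a, Unitization.ext (by simp) (by simp)⟩

theorem exists_inr_eq_inr_mul (a : A) (b : Unitization ℂ A) :
    ∃ a' : A, (a' : Unitization ℂ A) = a * b :=
  ⟨b.fst • a + a * b.snd, Unitization.ext (by simp) (by simp)⟩

/-- A closed ideal of `A`, regarded as a closed ideal of the unitization of `A`. -/
noncomputable def ClosedIdeal.unitization (K : ClosedIdeal A) : ClosedIdeal (Unitization ℂ A) where
  toSubmodule := K.toSubmodule.map (Unitization.inrHom ℂ ℂ A)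
  mul_mem_left' := by
    rintro b _ ⟨k, hk, rfl⟩
    exact ⟨b.fst • k + b.snd * k, add_mem (SMulMemClass.smul_mem _ hk) (K.mul_mem_left _ hk),
      Unitization.ext (by simp) (by simp)⟩
  mul_mem_right' := by
    rintro b _ ⟨k, hk, rfl⟩
    exact ⟨b.fst • k + k * b.snd, add_mem (SMulMemClass.smul_mem _ hk) (K.mul_mem_right _ hk),
      Unitization.ext (by simp) (by simp)⟩
  isClosed' := (Unitization.isometry_inr (𝕜 := ℂ) (A := A)).isClosedEmbedding.isClosedMap _
    K.isClosed

theorem ClosedIdeal.inr_mem_unitization {K : ClosedIdeal A} {a : A} :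
    (a : Unitization ℂ A) ∈ K.unitization ↔ a ∈ K :=
  ⟨fun ⟨_, hk, h⟩ => Unitization.inr_injective h ▸ hk, fun h => ⟨a, h, rfl⟩⟩

/-- The kernel of a representation, as a closed ideal. -/
noncomputable def ClosedIdeal.ker {H : Type*} [NormedAddCommGroup H] [InnerProductSpace ℂ H]
    [CompleteSpace H] (π : A →⋆ₙₐ[ℂ] (H →L[ℂ] H)) : ClosedIdeal A where
  toSubmodule := LinearMap.ker (π : A →ₗ[ℂ] (H →L[ℂ] H))
  mul_mem_left' x a (ha : π a = 0) := show π (x * a) = 0 by rw [map_mul, ha, mul_zero]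
  mul_mem_right' x a (ha : π a = 0) := show π (a * x) = 0 by rw [map_mul, ha, zero_mul]
  isClosed' := isClosed_singleton.preimage (map_continuous π)

theorem ClosedIdeal.exists_primitive (K : ClosedIdeal A) {a : A} (ha : a ∉ K) :
    ∃ P : Prim A, K ≤ P.1 ∧ a ∉ P.1 := by
  let _ := CStarAlgebra.spectralOrder A
  let _ := CStarAlgebra.spectralOrderedRing A
  have haK : ((star a * a : A) : Unitization ℂ A) ∉ K.unitization := by
    rwa [inr_mem_unitization, K.star_mul_self_mem_iff]
  obtain ⟨H, _, _, _, π, hπ, hπK, hπa⟩ := K.unitization.exists_isIrreducibleRep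
    (Unitization.inr_nonneg_iff.mpr (star_mul_self_nonneg a)) haK
  let ρ := π.comp (Unitization.inrNonUnitalStarAlgHom ℂ A)
  have hρ : IsIrreducibleRep ρ :=
    hπ.comp exists_inr_eq_mul_inr exists_inr_eq_inr_mul ⟨star a * a, hπa⟩
  refine ⟨⟨ker ρ, H, _, _, _, ρ, hρ, fun _ => Iff.rfl⟩,
    fun k hk => hπK _ (inr_mem_unitization.mpr hk), fun h => hπa ?_⟩
  exact (ker ρ).mul_mem_left (star a) h

theorem ClosedIdeal.eq_top_of_forall_not_le (K : ClosedIdeal A) (h : ∀ P : Prim A, ¬ K ≤ P.1) :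
    K = ⊤ := by
  refine top_le_iff.mp fun a _ => ?_
  by_contra ha
  obtain ⟨P, hP, -⟩ := K.exists_primitive ha
  exact h P hP

theorem Prim.exists_notMem (P : Prim A) : ∃ a, a ∉ P.1 := by
  obtain ⟨_, _, _, _, _, π, ⟨⟨a, ha⟩, _⟩, hker⟩ := P
  exact ⟨a, fun h => ha ((hker a).mp h)⟩

end Primitive

/-! ### Compact ideals, full elements and compactness of the primitive ideal space -/

section Compactness

variable {A : Type u} [NonUnitalCStarAlgebra A]

namespace ClosedIdeal

/-- The intersection of a closed ideal of `A` with `I`, as a closed ideal of `I`. -/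
noncomputable def comap (I J : ClosedIdeal A) : ClosedIdeal I where
  toSubmodule := J.toSubmodule.comap (SMulMemClass.subtype I)
  mul_mem_left' _ _ ha := J.mul_mem_left _ ha
  mul_mem_right' _ _ ha := J.mul_mem_right _ ha
  isClosed' := J.isClosed.preimage continuous_subtype_val

theorem mem_comap {I J : ClosedIdeal A} {x : I} : x ∈ I.comap J ↔ (x : A) ∈ J := Iff.rfl

theorem mk_mul_mem {I : ClosedIdeal A} (L : ClosedIdeal I) (x : A) {l : I} (hl : l ∈ L) :
    (⟨x * l, I.mul_mem_left x l.2⟩ : I) ∈ L := by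
  refine L.mem_of_star_mul_self_mem ?_
  have hz : star (⟨x * l, I.mul_mem_left x l.2⟩ : I) * ⟨x * l, I.mul_mem_left x l.2⟩ =
      star l * ⟨star x * (x * l), I.mul_mem_left _ (I.mul_mem_left x l.2)⟩ := Subtype.ext <| by
    change star (x * (l : A)) * (x * l) = star (l : A) * (star x * (x * l))
    rw [star_mul, mul_assoc]
  rw [hz]
  exact L.mul_mem_right _ (star_mem hl)

theorem mk_mul_mem' {I : ClosedIdeal A} (L : ClosedIdeal I) (x : A) {l : I} (hl : l ∈ L) :
    (⟨l * x, I.mul_mem_right x l.2⟩ : I) ∈ L := by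
  have hz : (⟨l * x, I.mul_mem_right x l.2⟩ : I) =
      star ⟨star x * (star l : I), I.mul_mem_left _ (star l).2⟩ := Subtype.ext <| by
    change (l : A) * x = star (star x * star (l : A))
    rw [star_mul, star_star, star_star]
  rw [hz]
  exact star_mem (mk_mul_mem L (star x) (star_mem hl))

/-- A closed ideal of the ideal `I`, regarded as a closed ideal of `A`. -/
noncomputable def map (I : ClosedIdeal A) (L : ClosedIdeal I) : ClosedIdeal A where
  toSubmodule := L.toSubmodule.map (SMulMemClass.subtype I)
  mul_mem_left' := by
    rintro x _ ⟨l, hl, rfl⟩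
    exact ⟨_, mk_mul_mem L x hl, rfl⟩
  mul_mem_right' := by
    rintro x _ ⟨l, hl, rfl⟩
    exact ⟨_, mk_mul_mem' L x hl, rfl⟩
  isClosed' := I.isClosed.isClosedEmbedding_subtypeVal.isClosedMap _ L.isClosed

theorem isFull_iff {I : ClosedIdeal A} {e : I} : IsFull e ↔ span {(e : A)} = I := by
  refine ⟨fun h => le_antisymm (span_singleton_le_iff.mpr e.2) fun x hx => ?_,
    fun h => top_le_iff.mp fun x _ => ?_⟩
  · have hle : span {e} ≤ I.comap (span {(e : A)}) :=
      span_singleton_le_iff.mpr (mem_comap.mpr (mem_span_singleton_self _))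
    rw [IsFull] at h
    rw [h] at hle
    exact hle (mem_top (⟨x, hx⟩ : I))
  · have hle : span {(e : A)} ≤ I.map (span {e}) :=
      span_singleton_le_iff.mpr ⟨e, mem_span_singleton_self e, rfl⟩
    rw [h] at hle
    obtain ⟨y, hy, hyx⟩ := hle x.2
    rwa [← Subtype.ext hyx]

end ClosedIdeal

namespace IsTwoSidedIdeal

variable {U : Submodule ℂ A}

theorem comap (hU : IsTwoSidedIdeal U) (I : ClosedIdeal A) :
    IsTwoSidedIdeal (U.comap (SMulMemClass.subtype I)) := fun x a ha => hU x a ha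

/-- If `y ∈ U` is close to `c ∈ I`, then `star c * y ∈ U ∩ I` is close to `star c * c`. -/
theorem dense_comap (hU : IsTwoSidedIdeal U) {I : ClosedIdeal A} (hI : I ≤ hU.closure) :
    Dense (U.comap (SMulMemClass.subtype I) : Set I) := fun c => by
  refine (hU.comap I).closure.mem_of_star_mul_self_mem (Metric.mem_closure_iff.mpr fun ε hε => ?_)
  have hc : star (c : A) * c ∈ _root_.closure ((fun y => star (c : A) * y) '' (U : Set A)) :=
    map_mem_closure (continuous_const_mul _) (hI c.2) fun y hy => ⟨y, hy, rfl⟩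
  obtain ⟨_, ⟨y, hy, rfl⟩, hd⟩ := Metric.mem_closure_iff.mp hc ε hε
  exact ⟨⟨star (c : A) * y, I.mul_mem_right y (star_mem c.2)⟩, (hU _ y hy).1, hd⟩

theorem mem_of_mem_pedersenIdeal (hU : IsTwoSidedIdeal U) {I : ClosedIdeal A}
    (hI : I ≤ hU.closure) {e : I} (he : e ∈ pedersenIdeal I) : (e : A) ∈ U :=
  (hU.comap I).pedersenIdeal_le (hU.dense_comap hI) he

end IsTwoSidedIdeal

theorem ClosedIdeal.isCompactElement_span {e : A}
    (h : ∀ (U : Submodule ℂ A) (hU : IsTwoSidedIdeal U), span {e} ≤ hU.closure → e ∈ U) :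
    IsCompactElement (span {e}) := by
  rw [CompleteLattice.isCompactElement_iff_le_of_directed_sSup_le]
  intro D hne hD hle
  have he := h _ _ (hle.trans (sSup_le_closure D))
  obtain ⟨_, ⟨J, hJ, rfl⟩, heJ⟩ := (Submodule.mem_sSup_of_directed (hne.image _)
    (hD.mono_comp (r := (· ≤ ·)) (g := ClosedIdeal.toSubmodule) fun _ _ hKL => hKL)).mp he
  exact ⟨J, hJ, span_singleton_le_iff.mpr heJ⟩

theorem ClosedIdeal.isCompactElement_of_isFull {I : ClosedIdeal A} {e : I}
    (he : e ∈ pedersenIdeal I) (hf : IsFull e) : IsCompactElement I := by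
  have hspan := isFull_iff.mp hf
  rw [← hspan]
  exact isCompactElement_span fun U hU hle => hU.mem_of_mem_pedersenIdeal (hspan ▸ hle) he

theorem isCompactElement_top_of_isFull {e : A} (he : e ∈ pedersenIdeal A) (hf : IsFull e) :
    IsCompactElement (⊤ : ClosedIdeal A) := by
  rw [← hf]
  refine ClosedIdeal.isCompactElement_span fun U hU hle => hU.pedersenIdeal_le (fun x => ?_) he
  exact hle (hf ▸ ClosedIdeal.mem_top x)

theorem compactSpace_prim_of_isCompactElement_top (h : IsCompactElement (⊤ : ClosedIdeal A)) :
    CompactSpace (Prim A) := by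
  refine compactSpace_generateFrom rfl fun 𝒰 h𝒰 hcov => ?_
  set 𝒦 : Set (ClosedIdeal A) := {K | {P : Prim A | K ≤ P.1}ᶜ ∈ 𝒰}
  have hsup : sSup 𝒦 = ⊤ := by
    refine ClosedIdeal.eq_top_of_forall_not_le _ fun P hP => ?_
    obtain ⟨V, hV, hPV⟩ : P ∈ ⋃₀ 𝒰 := hcov ▸ Set.mem_univ P
    obtain ⟨K, rfl⟩ := h𝒰 hV
    exact hPV ((le_sSup (show K ∈ 𝒦 from hV)).trans hP)
  obtain ⟨t, ht, htop⟩ :=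
    (CompleteLattice.isCompactElement_iff_exists_le_sSup_of_le_sSup _ _).mp h 𝒦 hsup.ge
  refine ⟨(fun K : ClosedIdeal A => {P : Prim A | K ≤ P.1}ᶜ) '' t, Set.image_subset_iff.mpr ht,
    t.finite_toSet.image _, Set.eq_univ_of_forall fun P => ?_⟩
  by_contra hP
  have hle : t.sup id ≤ P.1 := Finset.sup_le fun K hK => not_not.mp fun hKP =>
    hP ⟨_, ⟨K, hK, rfl⟩, hKP⟩
  obtain ⟨a, ha⟩ := P.exists_notMem
  exact ha (hle (htop (ClosedIdeal.mem_top a)))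

theorem Prim.isOpen_setOf_notMem (a : A) : IsOpen {P : Prim A | a ∉ P.1} :=
  TopologicalSpace.isOpen_generateFrom_of_mem
    ⟨ClosedIdeal.span {a}, by simp only [ClosedIdeal.span_singleton_le_iff]; rfl⟩

open Trace

theorem Prim.exists_cutDown_notMem [PartialOrder A] [StarOrderedRing A] (P : Prim A) :
    ∃ (a : Pos A) (ε : ℝ), 0 < ε ∧ (cutDown a ε : A) ∉ P.1 := by
  obtain ⟨a, ha⟩ := P.exists_notMem
  rw [← P.1.star_mul_self_mem_iff] at ha
  by_contra! h
  exact ha (mem_of_forall_cutDown_mem P.1 (a := ⟨star a * a, star_mul_self_nonneg a⟩) (h _))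

/-- Finitely many cut-downs lie outside enough primitive ideals; their sum is full. -/
theorem exists_isFull_of_compactSpace_prim [CompactSpace (Prim A)] :
    ∃ e : A, e ∈ pedersenIdeal A ∧ IsFull e := by
  let _ := CStarAlgebra.spectralOrder A
  let _ := CStarAlgebra.spectralOrderedRing A
  obtain ⟨t, ht⟩ := isCompact_univ.elim_finite_subcover
    (fun p : Pos A × {ε : ℝ // 0 < ε} => {P : Prim A | (cutDown p.1 p.2 : A) ∉ P.1})
    (fun p => Prim.isOpen_setOf_notMem _) fun P _ => by
      obtain ⟨a, ε, hε, h⟩ := P.exists_cutDown_notMem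
      exact Set.mem_iUnion.mpr ⟨(a, ⟨ε, hε⟩), h⟩
  refine ⟨∑ p ∈ t, (cutDown p.1 p.2 : A),
    Submodule.sum_mem _ fun p _ => mem_pedersenIdeal_of_mul_eq_self (plateau_mul_cutDown p.1 p.2.2),
    ClosedIdeal.eq_top_of_forall_not_le _ fun P hP => ?_⟩
  obtain ⟨p, hp, hpP⟩ := Set.mem_iUnion₂.mp (ht (Set.mem_univ P))
  refine hpP (P.1.mem_of_nonneg_of_le (cutDown p.1 p.2).2 ?_
    (ClosedIdeal.span_singleton_le_iff.mp hP))
  exact Finset.single_le_sum (f := fun p : Pos A × {ε : ℝ // 0 < ε} => (cutDown p.1 p.2 : A))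
    (fun p _ => (cutDown p.1 p.2).2) hp

section Order

variable [PartialOrder A] [StarOrderedRing A]

namespace ClosedIdeal

theorem span_cutDown_anti (b : Pos A) {s t : ℝ} (hs : 0 ≤ s) (hst : s ≤ t) :
    span {(cutDown b t : A)} ≤ span {(cutDown b s : A)} :=
  span_singleton_le_iff.mpr (mem_of_nonneg_of_le _ (cutDown b _).2 (cutDown_le b hs hst)
    (mem_span_singleton_self _))

theorem exists_span_cutDown_eq {b : Pos A} (hb : IsCompactElement (span {(b : A)})) :
    ∃ ε, 0 < ε ∧ span {(cutDown b ε : A)} = span {(b : A)} := by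
  set D : Set (ClosedIdeal A) := (fun ε : ℝ => span {(cutDown b ε : A)}) '' Set.Ioi 0
  have hdir : DirectedOn (· ≤ ·) D := by
    rintro _ ⟨s, hs, rfl⟩ _ ⟨t, ht, rfl⟩
    have hst : 0 < min s t := lt_min hs ht
    exact ⟨_, ⟨min s t, hst, rfl⟩, span_cutDown_anti b hst.le (min_le_left s t),
      span_cutDown_anti b hst.le (min_le_right s t)⟩
  have hsup : span {(b : A)} ≤ sSup D := by
    refine span_singleton_le_iff.mpr (mem_of_forall_cutDown_mem _ fun ε hε => ?_)
    exact (le_sSup ⟨ε, hε, rfl⟩ : _ ≤ sSup D) (mem_span_singleton_self _)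
  obtain ⟨_, ⟨ε, hε, rfl⟩, hle⟩ :=
    (CompleteLattice.isCompactElement_iff_le_of_directed_sSup_le _ _).mp hb D
      ⟨_, 1, Set.mem_Ioi.mpr one_pos, rfl⟩ hdir hsup
  exact ⟨ε, hε, le_antisymm
    (span_singleton_le_iff.mpr (cutDown_mem _ (mem_span_singleton_self _) ε)) hle⟩

theorem exists_isFull_of_isCompactElement {I : ClosedIdeal A} (hgen : I.IsSinglyGenerated)
    (hI : IsCompactElement I) : ∃ e : I, 0 ≤ (e : A) ∧ e ∈ pedersenIdeal I ∧ IsFull e := by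
  obtain ⟨a, rfl⟩ := hgen
  set b : Pos A := ⟨star a * a, star_mul_self_nonneg a⟩
  have hb : span {(b : A)} = span {a} := span_star_mul_self a
  obtain ⟨ε, hε, hs⟩ := exists_span_cutDown_eq (b := b) (hb ▸ hI)
  have hbI : (b : A) ∈ span {a} := hb ▸ mem_span_singleton_self _
  exact ⟨⟨cutDown b ε, cutDown_mem _ hbI ε⟩, (cutDown b ε).2,
    cutDown_mem_pedersenIdeal _ hbI hε, isFull_iff.mpr (hs.trans hb)⟩

theorem tfae_compact (I : ClosedIdeal A) :
    List.TFAE [I.IsSinglyGenerated ∧ IsCompactElement I, ∃ e : I, e ∈ pedersenIdeal I ∧ IsFull e,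
      CompactSpace (Prim I)] := by
  tfae_have 1 → 2
  | ⟨hgen, hI⟩ =>
    let ⟨e, _, he⟩ := exists_isFull_of_isCompactElement hgen hI
    ⟨e, he⟩
  tfae_have 2 → 1
  | ⟨e, he, hf⟩ => ⟨⟨e, (isFull_iff.mp hf).symm⟩, isCompactElement_of_isFull he hf⟩
  tfae_have 2 → 3
  | ⟨_, he, hf⟩ => compactSpace_prim_of_isCompactElement_top (isCompactElement_top_of_isFull he hf)
  tfae_have 3 → 2
  | _ => exists_isFull_of_compactSpace_prim
  tfae_finish

end ClosedIdeal

end Order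

end Compactness

/-! ### Invariant order ideals of the positive cone and tracial weights -/

section OrderIdeals

variable {A : Type u} [NonUnitalCStarAlgebra A] [PartialOrder A] [StarOrderedRing A]

namespace Trace

/-- The positive element `x⋆x`. -/
def starMulSelf (x : A) : Pos A := ⟨star x * x, star_mul_self_nonneg x⟩

noncomputable instance : SMul ℝ≥0 (Pos A) where
  smul r a := ⟨(r : ℝ) • a.1, smul_nonneg r.2 a.2⟩

theorem coe_starMulSelf (x : A) : (starMulSelf x : A) = star x * x := rfl

theorem coe_smul (r : ℝ≥0) (a : Pos A) : ((r • a : Pos A) : A) = (r : ℝ) • (a : A) := rfl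

theorem zero_smul_pos (a : Pos A) : (0 : ℝ≥0) • a = 0 := Subtype.ext (zero_smul ℝ (a : A))

theorem smul_le_nsmul_ceil (r : ℝ≥0) (a : Pos A) : r • a ≤ ⌈r⌉₊ • a := by
  change (r : ℝ) • (a : A) ≤ ⌈r⌉₊ • (a : A)
  rw [← Nat.cast_smul_eq_nsmul ℝ]
  exact smul_le_smul_of_nonneg_right (by exact_mod_cast Nat.le_ceil r) a.2

theorem exists_eq_starMulSelf (a : Pos A) : ∃ x, a = starMulSelf x := by
  obtain ⟨x, hx⟩ := CStarAlgebra.nonneg_iff_eq_star_mul_self.mp a.2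
  exact ⟨x, Subtype.ext hx⟩

theorem starMulSelf_star (x : A) :
    starMulSelf (star x) = ⟨x * star x, mul_star_self_nonneg x⟩ :=
  Subtype.ext (by rw [coe_starMulSelf, star_star])

theorem starMulSelf_smul (c : ℂ) (x : A) :
    starMulSelf (c • x) = (‖c‖₊ ^ 2) • starMulSelf x := by
  refine Subtype.ext ?_
  rw [coe_smul, coe_starMulSelf, coe_starMulSelf, star_smul, smul_mul_assoc, mul_smul_comm,
    smul_smul, Complex.star_def, Complex.conj_mul', ← Complex.coe_smul]
  push_cast
  rfl

theorem starMulSelf_mul_le (b x : A) : starMulSelf (b * x) ≤ ‖star b * b‖₊ • starMulSelf x := by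
  rw [← Subtype.coe_le_coe, coe_smul, coe_starMulSelf, coe_starMulSelf, star_mul, mul_assoc,
    ← mul_assoc (star b), ← mul_assoc (star x)]
  exact CStarAlgebra.star_left_conjugate_le_norm_smul

theorem coe_starMulSelf_mul (c w : A) :
    (starMulSelf (c * w) : A) = star w * starMulSelf c * w := by
  rw [coe_starMulSelf, coe_starMulSelf, star_mul]
  noncomm_ring

theorem starMulSelf_add_le (x y : A) :
    starMulSelf (x + y) ≤ (starMulSelf x + starMulSelf y) + (starMulSelf x + starMulSelf y) := by
  have parallelogram : (star x * x + star y * y) + (star x * x + star y * y)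
      - star (x + y) * (x + y) = star (x - y) * (x - y) := by
    rw [star_add, star_sub]
    noncomm_ring
  exact Subtype.coe_le_coe.mp (sub_nonneg.mp (parallelogram ▸ star_mul_self_nonneg (x - y)))

theorem starMulSelf_sqrtCutDown (a : Pos A) {ε : ℝ} (hε : 0 ≤ ε) :
    starMulSelf (sqrtCutDown (a : A) ε) = cutDown a ε :=
  Subtype.ext <| by
    rw [coe_starMulSelf, (isSelfAdjoint_sqrtCutDown _ _).star_eq, sqrtCutDown_mul_self a hε]

/-- A subset of `A₊` that is closed under addition, hereditary, and contains `xx⋆` whenever it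
contains `x⋆x`. -/
structure IsInvariantOrderIdeal (C : Set (Pos A)) : Prop where
  protected zero_mem : 0 ∈ C
  protected add_mem : ∀ {a b}, a ∈ C → b ∈ C → a + b ∈ C
  mem_of_le : ∀ {a b : Pos A}, a ≤ b → b ∈ C → a ∈ C
  starMulSelf_star_mem : ∀ {x}, starMulSelf x ∈ C → starMulSelf (star x) ∈ C

namespace IsInvariantOrderIdeal

variable {C : Set (Pos A)}

protected theorem nsmul_mem (hC : IsInvariantOrderIdeal C) (n : ℕ) {a : Pos A} (ha : a ∈ C) :
    n • a ∈ C := by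
  induction n with
  | zero => rw [zero_nsmul]; exact hC.zero_mem
  | succ n ih => rw [succ_nsmul]; exact hC.add_mem ih ha

protected theorem smul_mem (hC : IsInvariantOrderIdeal C) (r : ℝ≥0) {a : Pos A} (ha : a ∈ C) :
    r • a ∈ C :=
  hC.mem_of_le (smul_le_nsmul_ceil r a) (hC.nsmul_mem _ ha)

/-- The two-sided ideal of all `x ∈ A` with `x⋆x ∈ C`. -/
def sqrtIdeal (hC : IsInvariantOrderIdeal C) : Submodule ℂ A where
  carrier := {x | starMulSelf x ∈ C}
  add_mem' {x y} hx hy :=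
    hC.mem_of_le (starMulSelf_add_le x y) (hC.add_mem (hC.add_mem hx hy) (hC.add_mem hx hy))
  zero_mem' := hC.mem_of_le (b := 0) (mul_zero (star (0 : A))).le hC.zero_mem
  smul_mem' c x hx := by
    rw [Set.mem_ofPred_eq, starMulSelf_smul]
    exact hC.smul_mem _ hx

theorem mem_sqrtIdeal (hC : IsInvariantOrderIdeal C) {x : A} :
    x ∈ hC.sqrtIdeal ↔ starMulSelf x ∈ C := Iff.rfl

theorem star_mem_sqrtIdeal (hC : IsInvariantOrderIdeal C) {x : A} (hx : x ∈ hC.sqrtIdeal) :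
    star x ∈ hC.sqrtIdeal := hC.starMulSelf_star_mem hx

theorem isTwoSidedIdeal_sqrtIdeal (hC : IsInvariantOrderIdeal C) :
    IsTwoSidedIdeal hC.sqrtIdeal := by
  have mul_left_mem : ∀ b x, x ∈ hC.sqrtIdeal → b * x ∈ hC.sqrtIdeal := fun b x hx =>
    hC.mem_of_le (starMulSelf_mul_le b x) (hC.smul_mem _ hx)
  refine fun b x hx => ⟨mul_left_mem b x hx, ?_⟩
  have := hC.star_mem_sqrtIdeal (mul_left_mem (star b) _ (hC.star_mem_sqrtIdeal hx))
  rwa [star_mul, star_star, star_star] at this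

theorem cutDown_mem_of_le_closure (hC : IsInvariantOrderIdeal C) {I : ClosedIdeal A}
    (hI : I ≤ hC.isTwoSidedIdeal_sqrtIdeal.closure) {a : Pos A} (ha : (a : A) ∈ I) {ε : ℝ}
    (hε : 0 < ε) : cutDown a ε ∈ C := by
  have := hC.isTwoSidedIdeal_sqrtIdeal.mem_of_mul_eq_self (hI (cfcₙ_mem _ ha))
    (plateau_mul_sqrtCutDown (a : A) hε)
  rwa [mem_sqrtIdeal, starMulSelf_sqrtCutDown a hε.le] at this

theorem star_mul_mem_span (hC : IsInvariantOrderIdeal C) {u v : A} (hu : u ∈ hC.sqrtIdeal)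
    (hv : v ∈ hC.sqrtIdeal) : star u * v ∈ Submodule.span ℂ (Subtype.val '' C) := by
  have mem (c : ℂ) : (starMulSelf (u + c • v) : A) ∈ Submodule.span ℂ (Subtype.val '' C) :=
    Submodule.subset_span ⟨_, hC.sqrtIdeal.add_mem hu (hC.sqrtIdeal.smul_mem c hv), rfl⟩
  have polarization : star u * v = (4 : ℂ)⁻¹ • ((starMulSelf (u + (1 : ℂ) • v) : A) -
      starMulSelf (u + (-1 : ℂ) • v) - Complex.I • (starMulSelf (u + Complex.I • v) : A) +
      Complex.I • (starMulSelf (u + (-Complex.I) • v) : A)) := by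
    simp only [coe_starMulSelf, star_add, star_smul, mul_add, add_mul, smul_mul_assoc,
      mul_smul_comm, star_neg, star_one, Complex.star_def, Complex.conj_I]
    match_scalars <;> ring_nf <;> simp only [Complex.I_sq] <;> ring
  rw [polarization]
  exact Submodule.smul_mem _ _ (add_mem (sub_mem (sub_mem (mem 1) (mem (-1)))
    (Submodule.smul_mem _ _ (mem _))) (Submodule.smul_mem _ _ (mem _)))

theorem isTwoSidedIdeal_span (hC : IsInvariantOrderIdeal C) :
    IsTwoSidedIdeal (Submodule.span ℂ (Subtype.val '' C)) := fun b z hz => by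
  induction hz using Submodule.span_induction with
  | mem z h =>
    obtain ⟨a, ha, rfl⟩ := h
    obtain ⟨x, rfl⟩ := exists_eq_starMulSelf a
    have hx : x ∈ hC.sqrtIdeal := ha
    have hxb := hC.star_mul_mem_span (hC.isTwoSidedIdeal_sqrtIdeal (star b) x hx).2 hx
    rw [star_mul, star_star, mul_assoc] at hxb
    refine ⟨hxb, ?_⟩
    rw [coe_starMulSelf, mul_assoc]
    exact hC.star_mul_mem_span hx (hC.isTwoSidedIdeal_sqrtIdeal b x hx).2
  | zero => rw [mul_zero, zero_mul]; exact ⟨zero_mem _, zero_mem _⟩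
  | add y z _ _ hy hz =>
    rw [mul_add, add_mul]
    exact ⟨add_mem hy.1 hz.1, add_mem hy.2 hz.2⟩
  | smul r z _ hz =>
    rw [mul_smul_comm, smul_mul_assoc]
    exact ⟨Submodule.smul_mem _ r hz.1, Submodule.smul_mem _ r hz.2⟩

theorem exists_smul_add_star_le (hC : IsInvariantOrderIdeal C) {z : A}
    (hz : z ∈ Submodule.span ℂ (Subtype.val '' C)) :
    ∃ w ∈ C, ∀ c : ℂ, c • z + star (c • z) ≤ ((‖c‖₊ • w : Pos A) : A) := by
  induction hz using Submodule.span_induction with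
  | mem z h =>
    obtain ⟨a, ha, rfl⟩ := h
    refine ⟨a + a, hC.add_mem ha ha, fun c => ?_⟩
    have hre : c • (a : A) + star (c • (a : A)) = (2 * c.re) • (a : A) := by
      rw [star_smul, (IsSelfAdjoint.of_nonneg a.2).star_eq, ← add_smul, Complex.star_def,
        Complex.add_conj, ← Complex.coe_smul]
    rw [hre, coe_smul, coe_nnnorm]
    change _ ≤ ‖c‖ • ((a : A) + a)
    rw [← two_smul ℝ (a : A), smul_smul, mul_comm]
    exact smul_le_smul_of_nonneg_right (by gcongr; exact c.re_le_norm) a.2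
  | zero =>
    refine ⟨0, hC.zero_mem, fun c => ?_⟩
    rw [smul_zero, star_zero, add_zero]
    exact (smul_zero _).ge
  | add y z _ _ hy hz =>
    obtain ⟨v, hv, hvy⟩ := hy
    obtain ⟨w, hw, hwz⟩ := hz
    refine ⟨v + w, hC.add_mem hv hw, fun c => ?_⟩
    calc c • (y + z) + star (c • (y + z))
        = (c • y + star (c • y)) + (c • z + star (c • z)) := by rw [smul_add, star_add]; abel
      _ ≤ _ := add_le_add (hvy c) (hwz c)
      _ = _ := (smul_add (‖c‖₊ : ℝ) (v : A) w).symm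
  | smul r z _ hz =>
    obtain ⟨w, hw, hwz⟩ := hz
    refine ⟨‖r‖₊ • w, hC.smul_mem _ hw, fun c => ?_⟩
    rw [smul_smul]
    refine (hwz (c * r)).trans_eq ?_
    simp only [coe_smul, smul_smul, nnnorm_mul, NNReal.coe_mul]

theorem mem_of_mem_pedersenIdeal (hC : IsInvariantOrderIdeal C) {I : ClosedIdeal A}
    (hI : ∀ a : Pos A, (a : A) ∈ I → ∀ ε, 0 < ε → cutDown a ε ∈ C) {e : I} (he : 0 ≤ (e : A))
    (heP : e ∈ pedersenIdeal I) : ⟨e, he⟩ ∈ C := by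
  have hle : I ≤ hC.isTwoSidedIdeal_span.closure := fun x hx => by
    rw [← ClosedIdeal.star_mul_self_mem_iff]
    exact mem_of_forall_cutDown_mem _ (a := starMulSelf x) fun ε hε =>
      IsTwoSidedIdeal.subset_closure _
        (Submodule.subset_span ⟨_, hI _ (I.mul_mem_left _ hx) ε hε, rfl⟩)
  obtain ⟨w, hw, hwe⟩ :=
    hC.exists_smul_add_star_le (hC.isTwoSidedIdeal_span.mem_of_mem_pedersenIdeal hle heP)
  refine hC.mem_of_le (b := ‖(1 : ℂ)‖₊ • w) ?_ (hC.smul_mem _ hw)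
  have h1 := hwe 1
  rw [one_smul, (IsSelfAdjoint.of_nonneg he).star_eq] at h1
  exact (le_add_of_nonneg_left he).trans h1

end IsInvariantOrderIdeal

/-- An additive, positively homogeneous and tracial map `A₊ → [0, ∞]`, not necessarily lower
semicontinuous. -/
structure IsTracial (f : Pos A → ℝ≥0∞) : Prop where
  map_add : ∀ a b, f (a + b) = f a + f b
  map_smul : ∀ (r : ℝ≥0) (a : Pos A), f (r • a) = r * f a
  map_star : ∀ x, f (starMulSelf (star x)) = f (starMulSelf x)

theorem isTracial (τ : Trace A) : IsTracial τ where
  map_add := τ.map_add'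
  map_smul r a := by
    rcases eq_or_ne r 0 with rfl | hr
    · rw [zero_smul_pos, ENNReal.coe_zero, zero_mul]
      exact τ.map_zero'
    · exact τ.map_smul' r a (pos_iff_ne_zero.mpr hr)
  map_star x := by rw [starMulSelf_star]; exact τ.map_mul_star' x

namespace IsTracial

variable {f g : Pos A → ℝ≥0∞}

theorem map_zero (hf : IsTracial f) : f 0 = 0 := by
  rw [← zero_smul_pos 0, hf.map_smul, ENNReal.coe_zero, zero_mul]

theorem map_add_sub (hf : IsTracial f) {a b : Pos A} (h : a ≤ b) :
    f b = f a + f ⟨(b : A) - a, sub_nonneg.mpr h⟩ := by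
  rw [← hf.map_add]
  exact congrArg f (Subtype.ext (add_sub_cancel (a : A) (b : A)).symm)

theorem mono (hf : IsTracial f) {a b : Pos A} (h : a ≤ b) : f a ≤ f b := by
  rw [hf.map_add_sub h]
  exact le_self_add

theorem isInvariantOrderIdeal_lt_top (hf : IsTracial f) :
    IsInvariantOrderIdeal {a | f a < ∞} where
  zero_mem := hf.map_zero.trans_lt ENNReal.zero_lt_top
  add_mem ha hb := (hf.map_add _ _).trans_lt (ENNReal.add_lt_top.mpr ⟨ha, hb⟩)
  mem_of_le h hb := (hf.mono h).trans_lt hb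
  starMulSelf_star_mem hx := (hf.map_star _).trans_lt hx

theorem isInvariantOrderIdeal_eq (hf : IsTracial f) (hg : IsTracial g) (hfg : f ≤ g) :
    IsInvariantOrderIdeal {a | f a = g a ∧ g a < ∞} where
  zero_mem := ⟨hf.map_zero.trans hg.map_zero.symm, hg.map_zero.trans_lt ENNReal.zero_lt_top⟩
  add_mem ha hb :=
    ⟨by rw [hf.map_add, hg.map_add, ha.1, hb.1], hg.isInvariantOrderIdeal_lt_top.add_mem ha.2 hb.2⟩
  mem_of_le {a b} h hb := by
    set d : Pos A := ⟨(b : A) - a, sub_nonneg.mpr h⟩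
    have hd : g d ≠ ∞ := by
      have hgb := hb.2
      rw [hg.map_add_sub h] at hgb
      exact (ENNReal.add_lt_top.mp hgb).2.ne
    have hba : g a + g d ≤ f a + g d := calc
      g a + g d = f a + f d := by rw [← hg.map_add_sub h, ← hb.1, hf.map_add_sub h]
      _ ≤ f a + g d := by gcongr; exact hfg d
    exact ⟨(hfg a).antisymm ((ENNReal.add_le_add_iff_right hd).mp hba), (hg.mono h).trans_lt hb.2⟩
  starMulSelf_star_mem hx := by
    rw [Set.mem_ofPred_eq, hf.map_star, hg.map_star]
    exact hx

end IsTracial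

end Trace

end OrderIdeals

/-! ### Traces with a prescribed support idempotent -/

section Supports

variable {A : Type u} [NonUnitalCStarAlgebra A] [PartialOrder A] [StarOrderedRing A]

namespace Trace

theorem le_of_forall_cutDown_le (τ : Trace A) {a : Pos A} {c : ℝ≥0∞}
    (h : ∀ ε, 0 < ε → τ (cutDown a ε) ≤ c) : τ a ≤ c := by
  have hcl : IsClosed {b : Pos A | τ b ≤ c} := τ.lsc'.isClosed_preimage c
  refine hcl.closure_subset (Metric.mem_closure_iff.mpr fun ε hε =>
    ⟨cutDown a (ε / 2), h _ (half_pos hε), ?_⟩)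
  rw [Subtype.dist_eq, dist_eq_norm]
  exact (norm_sub_cutDown_le a (half_pos hε).le).trans_lt (half_lt_self hε)

theorem ofIdeal_of_mem {I : ClosedIdeal A} {a : Pos A} (ha : (a : A) ∈ I) : ofIdeal I a = 0 :=
  if_pos ha

theorem ofIdeal_of_notMem {I : ClosedIdeal A} {a : Pos A} (ha : (a : A) ∉ I) : ofIdeal I a = ∞ :=
  if_neg ha

theorem ofIdeal_add_self (I : ClosedIdeal A) : ofIdeal I + ofIdeal I = ofIdeal I :=
  ext fun a => by
    rw [add_apply]
    by_cases ha : (a : A) ∈ I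
    · rw [ofIdeal_of_mem ha, add_zero]
    · rw [ofIdeal_of_notMem ha, add_top]

theorem starMulSelf_mem_iff (I : ClosedIdeal A) {x : A} : (starMulSelf x : A) ∈ I ↔ x ∈ I :=
  I.star_mul_self_mem_iff

theorem ofIdeal_le_ofIdeal_iff {I J : ClosedIdeal A} : ofIdeal I ≤ ofIdeal J ↔ J ≤ I := by
  refine ⟨fun h x hx => ?_, fun h a => ?_⟩
  · by_contra hI
    have hle : ofIdeal I (starMulSelf x) ≤ ofIdeal J (starMulSelf x) := h _
    rw [ofIdeal_of_mem ((starMulSelf_mem_iff J).mpr hx),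
      ofIdeal_of_notMem (mt (starMulSelf_mem_iff I).mp hI)] at hle
    exact ENNReal.top_ne_zero (le_zero_iff.mp hle)
  · change ofIdeal I a ≤ ofIdeal J a
    by_cases ha : (a : A) ∈ J
    · rw [ofIdeal_of_mem (h ha)]
      exact zero_le
    · rw [ofIdeal_of_notMem ha]
      exact le_top

theorem ofIdeal_injective : Function.Injective (ofIdeal : ClosedIdeal A → Trace A) :=
  fun _ _ h => le_antisymm (ofIdeal_le_ofIdeal_iff.mp h.ge) (ofIdeal_le_ofIdeal_iff.mp h.le)

/-- The closed ideal generated by the positive elements on which a trace is finite, encoded as the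
closure of the ideal of all `x` with `τ (x⋆x) < ∞`. -/
def finiteIdeal (τ : Trace A) : ClosedIdeal A :=
  τ.isTracial.isInvariantOrderIdeal_lt_top.isTwoSidedIdeal_sqrtIdeal.closure

theorem mem_finiteIdeal_of_lt_top (τ : Trace A) {a : Pos A} (h : τ a < ∞) :
    (a : A) ∈ τ.finiteIdeal := by
  obtain ⟨x, rfl⟩ := exists_eq_starMulSelf a
  exact (starMulSelf_mem_iff _).mpr (IsTwoSidedIdeal.subset_closure _ h)

theorem eq_top_of_notMem_finiteIdeal (τ : Trace A) {a : Pos A} (h : (a : A) ∉ τ.finiteIdeal) :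
    τ a = ∞ :=
  not_lt_top_iff.mp (mt τ.mem_finiteIdeal_of_lt_top h)

theorem finiteIdeal_le_iff (τ : Trace A) {I : ClosedIdeal A} :
    τ.finiteIdeal ≤ I ↔ ∀ a : Pos A, (a : A) ∉ I → τ a = ∞ := by
  refine ⟨fun h a ha => τ.eq_top_of_notMem_finiteIdeal (mt (@h _) ha), fun h => ?_⟩
  refine (IsTwoSidedIdeal.closure_le_iff _).mpr fun x hx => ?_
  by_contra hxI
  exact (LT.lt.ne hx) (h _ (mt (starMulSelf_mem_iff I).mp hxI))

theorem le_finiteIdeal_iff (τ : Trace A) {I : ClosedIdeal A} :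
    I ≤ τ.finiteIdeal ↔ ∀ a : Pos A, (a : A) ∈ I → ∀ ε, 0 < ε → τ (cutDown a ε) < ∞ := by
  refine ⟨fun h a ha ε hε =>
    τ.isTracial.isInvariantOrderIdeal_lt_top.cutDown_mem_of_le_closure h ha hε, fun h x hx => ?_⟩
  rw [← starMulSelf_mem_iff]
  exact mem_of_forall_cutDown_mem _ fun ε hε =>
    τ.mem_finiteIdeal_of_lt_top (h _ ((starMulSelf_mem_iff I).mpr hx) ε hε)

theorem continuous_starMulSelf : Continuous (starMulSelf : A → Pos A) :=
  Continuous.subtype_mk (by fun_prop) _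

theorem eq_zero_of_mem_finiteIdeal {σ τ : Trace A} (hσ : σ + σ = σ) (hστ : σ ≤ τ) {a : Pos A}
    (ha : (a : A) ∈ τ.finiteIdeal) : σ a = 0 := by
  obtain ⟨x, rfl⟩ := exists_eq_starMulSelf a
  have hcl : IsClosed {x : A | σ (starMulSelf x) ≤ 0} :=
    (σ.lsc'.isClosed_preimage 0).preimage continuous_starMulSelf
  refine le_zero_iff.mp (closure_minimal (fun y hy => ?_) hcl ((starMulSelf_mem_iff _).mp ha))
  have hfin : σ (starMulSelf y) < ∞ := (hστ _).trans_lt hy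
  have hadd : σ (starMulSelf y) + σ (starMulSelf y) = σ (starMulSelf y) + 0 := by
    rw [← add_apply, hσ, add_zero]
  exact ((ENNReal.add_right_inj hfin.ne).mp hadd).le

theorem isLUB_ofIdeal_finiteIdeal (τ : Trace A) :
    IsLUB {σ : Trace A | σ + σ = σ ∧ σ ≤ τ} (ofIdeal τ.finiteIdeal) := by
  refine IsGreatest.isLUB ⟨⟨ofIdeal_add_self _, fun a => ?_⟩, fun σ ⟨hσ, hστ⟩ a => ?_⟩
  · change ofIdeal _ a ≤ τ a
    by_cases ha : (a : A) ∈ τ.finiteIdeal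
    · rw [ofIdeal_of_mem ha]
      exact zero_le
    · rw [τ.eq_top_of_notMem_finiteIdeal ha]
      exact le_top
  · change σ a ≤ ofIdeal _ a
    by_cases ha : (a : A) ∈ τ.finiteIdeal
    · rw [eq_zero_of_mem_finiteIdeal hσ hστ ha]
      exact zero_le
    · rw [ofIdeal_of_notMem ha]
      exact le_top

theorem mem_supportedOn_iff_finiteIdeal_eq {I : ClosedIdeal A} {τ : Trace A} :
    τ ∈ supportedOn I ↔ τ.finiteIdeal = I :=
  ⟨fun h => ofIdeal_injective (τ.isLUB_ofIdeal_finiteIdeal.unique h),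
    fun h => h ▸ τ.isLUB_ofIdeal_finiteIdeal⟩

theorem mem_supportedOn_iff {I : ClosedIdeal A} {τ : Trace A} :
    τ ∈ supportedOn I ↔ (∀ a : Pos A, (a : A) ∈ I → ∀ ε, 0 < ε → τ (cutDown a ε) < ∞) ∧
      ∀ a : Pos A, (a : A) ∉ I → τ a = ∞ := by
  rw [mem_supportedOn_iff_finiteIdeal_eq, ← τ.le_finiteIdeal_iff, ← τ.finiteIdeal_le_iff,
    le_antisymm_iff, and_comm]

theorem lt_top_of_mem_pedersenIdeal {I : ClosedIdeal A} {τ : Trace A} (hτ : τ ∈ supportedOn I)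
    {e : I} (he : 0 ≤ (e : A)) (heP : e ∈ pedersenIdeal I) : τ ⟨e, he⟩ < ∞ :=
  τ.isTracial.isInvariantOrderIdeal_lt_top.mem_of_mem_pedersenIdeal
    (mem_supportedOn_iff.mp hτ).1 he heP

theorem isSubcone_supportedOn (I : ClosedIdeal A) : IsSubcone (supportedOn I) (ofIdeal I) where
  add_mem σ hσ τ hτ := by
    rw [mem_supportedOn_iff] at *
    refine ⟨fun a ha ε hε => ?_, fun a ha => ?_⟩ <;> rw [add_apply]
    · exact ENNReal.add_lt_top.mpr ⟨hσ.1 a ha ε hε, hτ.1 a ha ε hε⟩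
    · rw [hσ.2 a ha, top_add]
  smul_mem r hr τ hτ := by
    rw [mem_supportedOn_iff] at *
    refine ⟨fun a ha ε hε => ?_, fun a ha => ?_⟩ <;> rw [smul_apply]
    · exact ENNReal.mul_lt_top ENNReal.coe_lt_top (hτ.1 a ha ε hε)
    · rw [hτ.2 a ha, ENNReal.mul_top (ENNReal.coe_ne_zero.mpr hr.ne')]
  neutral_mem := by
    refine mem_supportedOn_iff.mpr ⟨fun a ha ε _ => ?_, fun a ha => ofIdeal_of_notMem ha⟩
    rw [ofIdeal_of_mem (cutDown_mem I ha ε)]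
    exact ENNReal.zero_lt_top
  add_neutral τ hτ := ext fun a => by
    rw [add_apply]
    by_cases ha : (a : A) ∈ I
    · rw [ofIdeal_of_mem ha, add_zero]
    · rw [(mem_supportedOn_iff.mp hτ).2 a ha, top_add]

theorem le_of_add_eq_add {I : ClosedIdeal A} {ρ σ τ : Trace A} (hρ : ρ ∈ supportedOn I)
    (hτ : τ ∈ supportedOn I) (h : σ + ρ = τ + ρ) : σ ≤ τ := by
  rw [mem_supportedOn_iff] at hρ hτ
  intro a
  change σ a ≤ τ a
  by_cases ha : (a : A) ∈ I
  · refine σ.le_of_forall_cutDown_le fun ε hε => ?_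
    have hadd : σ (cutDown a ε) + ρ (cutDown a ε) = τ (cutDown a ε) + ρ (cutDown a ε) := by
      rw [← add_apply, h, add_apply]
    rw [(ENNReal.add_left_inj (hρ.1 a ha ε hε).ne).mp hadd]
    exact τ.mono (cutDown_le_self a hε.le)
  · rw [hτ.2 a ha]
    exact le_top

theorem isCancellative_supportedOn (I : ClosedIdeal A) : IsCancellative (supportedOn I) :=
  fun _ hρ _ hσ _ hτ h => (le_of_add_eq_add hρ hτ h).antisymm (le_of_add_eq_add hρ hσ h.symm)

theorem isInvariantOrderIdeal_dominated (e : Pos A) :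
    IsInvariantOrderIdeal {b : Pos A | ∃ c : ℝ≥0, ∀ σ : Trace A, σ b ≤ c * σ e} where
  zero_mem := ⟨0, fun σ => by rw [σ.isTracial.map_zero]; exact zero_le⟩
  add_mem := by
    rintro a b ⟨c, hc⟩ ⟨d, hd⟩
    refine ⟨c + d, fun σ => ?_⟩
    rw [σ.isTracial.map_add, ENNReal.coe_add, add_mul]
    exact add_le_add (hc σ) (hd σ)
  mem_of_le := fun h ⟨c, hc⟩ => ⟨c, fun σ => (σ.mono h).trans (hc σ)⟩
  starMulSelf_star_mem := fun ⟨c, hc⟩ => ⟨c, fun σ => (σ.isTracial.map_star _).trans_le (hc σ)⟩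

theorem exists_forall_cutDown_le_mul {e a : Pos A} (ha : (a : A) ∈ ClosedIdeal.span {(e : A)})
    {ε : ℝ} (hε : 0 < ε) : ∃ c : ℝ≥0, ∀ σ : Trace A, σ (cutDown a ε) ≤ c * σ e := by
  have hC := isInvariantOrderIdeal_dominated e
  refine hC.cutDown_mem_of_le_closure (ClosedIdeal.span_singleton_le_iff.mpr ?_) ha hε
  obtain ⟨x, rfl⟩ := exists_eq_starMulSelf e
  refine (starMulSelf_mem_iff _).mpr (IsTwoSidedIdeal.subset_closure _ ?_)
  exact ⟨1, fun σ => by rw [ENNReal.coe_one, one_mul]⟩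

end Trace

end Supports

/-! ### Lower semicontinuous regularization of tracial weights -/

section Regularization

variable {A : Type u} [NonUnitalCStarAlgebra A] [PartialOrder A] [StarOrderedRing A]

namespace Trace

theorem exists_norm_sub_le_of_norm_sub_sq_le {E G : Type*} [SeminormedAddCommGroup E]
    [SeminormedAddCommGroup G] {F : E → G} (hF : Continuous F) (c : E) {δ : ℝ} (hδ : 0 < δ) :
    ∃ η > 0, ∀ d : E, ‖d - c‖ ^ 2 ≤ η → ‖F c - F d‖ ≤ δ := by
  obtain ⟨s, hs, h⟩ := Metric.continuous_iff.mp hF c δ hδ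
  refine ⟨(s / 2) ^ 2, by positivity, fun d hd => ?_⟩
  rw [sq_le_sq₀ (norm_nonneg _) (half_pos hs).le, ← dist_eq_norm] at hd
  rw [← dist_eq_norm, dist_comm]
  exact (h d (hd.trans_lt (half_lt_self hs))).le

theorem exists_cutDown_le_conjugate_sub (x : Pos A) {η δ : ℝ} (hη : 0 ≤ η) (hηδ : η < δ) :
    ∃ w : A, IsSelfAdjoint w ∧ ‖w‖ ≤ 1 ∧ (cutDown x δ : A) ≤ w * x * w - η • (w * w) := by
  have hd : 0 < δ - η := sub_pos.mpr hηδ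
  set g : ℝ → ℝ := fun t => max 0 (min 1 ((t - η) / (δ - η))) with hg
  have hg_cont : Continuous g := by fun_prop
  have hg_zero : ∀ t, t ≤ η → g t = 0 := fun t ht => max_eq_left
    ((min_le_right _ _).trans (div_nonpos_of_nonpos_of_nonneg (sub_nonpos.mpr ht) hd.le))
  have hg_one : ∀ t, δ ≤ t → g t = 1 := fun t ht => by
    simp only [hg]
    rw [min_eq_left ((one_le_div hd).mpr (by linarith)), max_eq_right zero_le_one]
  have hg0 : g 0 = 0 := hg_zero 0 hη
  refine ⟨cfcₙ g (x : A), .cfcₙ, norm_cfcₙ_le fun t _ => ?_, ?_⟩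
  · rw [Real.norm_eq_abs, abs_of_nonneg (le_max_left _ _)]
    exact max_le zero_le_one (min_le_left _ _)
  rw [cfcₙ_mul_self_mul_cfcₙ_sub_smul (.of_nonneg x.2) hg_cont hg0, coe_cutDown]
  refine cfcₙ_mono (fun t _ => ?_) (by fun_prop) (by fun_prop) (by simp; linarith) (by simp [hg0])
  rcases le_total t δ with htδ | htδ
  · rw [max_eq_left (sub_nonpos.mpr htδ)]
    rcases le_total t η with htη | htη
    · rw [hg_zero t htη, zero_mul, zero_mul]
    · exact mul_nonneg (mul_self_nonneg _) (sub_nonneg.mpr htη)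
  · rw [hg_one t htδ, max_eq_right (sub_nonneg.mpr htδ)]
    linarith

theorem exists_cutDown_le_conjugate {x y : Pos A} {η δ : ℝ} (hηδ : η < δ)
    (hxy : ‖(x : A) - y‖ ≤ η) :
    ∃ w : A, IsSelfAdjoint w ∧ ‖w‖ ≤ 1 ∧ (cutDown x δ : A) ≤ w * y * w := by
  obtain ⟨w, hw, hw1, hle⟩ :=
    exists_cutDown_le_conjugate_sub x ((norm_nonneg _).trans hxy) hηδ
  have hconj : w * ((x : A) - y) * w ≤ η • (w * w) :=
    conjugate_le_smul_of_norm_le hw (.sub (.of_nonneg x.2) (.of_nonneg y.2)) hxy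
  rw [mul_sub, sub_mul] at hconj
  exact ⟨w, hw, hw1, hle.trans (sub_le_comm.mp hconj)⟩

theorem exists_conjugate_eq_cutDown (x : Pos A) {η : ℝ} (hη : 0 < η) :
    ∃ w : A, IsSelfAdjoint w ∧ w * x * w = cutDown x η ∧
      ∀ c : A, star c * c ≤ x → ‖c * w - c‖ ^ 2 ≤ η := by
  set g : ℝ → ℝ := fun t => √(max 0 (t - η) / max t η) with hg
  have hpos : ∀ t, 0 < max t η := fun t => hη.trans_le (le_max_right _ _)
  have hg_cont : Continuous g :=
    .sqrt (.div (by fun_prop) (by fun_prop) fun t => (hpos t).ne')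
  have hg0 : g 0 = 0 := by
    simp only [hg]
    rw [max_eq_left (by linarith), zero_div, Real.sqrt_zero]
  have hg_sq : ∀ t, t * (g t * g t) = max 0 (t - η) := fun t => by
    simp only [hg]
    rw [Real.mul_self_sqrt (div_nonneg (le_max_left _ _) (hpos t).le)]
    rcases le_total t η with h | h
    · rw [max_eq_left (sub_nonpos.mpr h), zero_div, mul_zero]
    · rw [max_eq_left h, mul_div_cancel₀ _ (hη.trans_le h).ne']
  have hg_le : ∀ t, g t ≤ 1 := fun t => by
    refine Real.sqrt_le_one.mpr ((div_le_one (hpos t)).mpr (max_le (hpos t).le ?_))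
    exact (sub_le_self t hη.le).trans (le_max_left _ _)
  refine ⟨cfcₙ g (x : A), .cfcₙ, ?_, fun c hc =>
    norm_mul_cfcₙ_sub_sq_le hc hg_cont hg0 fun t ht => ?_⟩
  · rw [cfcₙ_mul_self_mul_cfcₙ (.of_nonneg x.2) hg_cont hg0, coe_cutDown]
    congr 1
    funext t
    rw [← hg_sq t]
    ring
  · have hle : (1 - g t) ^ 2 ≤ 1 - g t * g t := by
      nlinarith [hg_le t, (Real.sqrt_nonneg _ : 0 ≤ g t)]
    calc t * (1 - g t) ^ 2 ≤ t * (1 - g t * g t) := mul_le_mul_of_nonneg_left hle ht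
      _ = t - max 0 (t - η) := by rw [mul_sub, mul_one, hg_sq]
      _ ≤ η := by linarith [le_max_right 0 (t - η)]

theorem cutDown_smul {r : ℝ≥0} (a : Pos A) {ε : ℝ} (hε : 0 ≤ ε) :
    cutDown (r • a) (r * ε) = r • cutDown a ε := by
  have ha : IsSelfAdjoint (a : A) := .of_nonneg a.2
  refine Subtype.ext ?_
  rw [coe_cutDown, coe_smul, coe_smul, coe_cutDown,
    ← cfcₙ_comp_smul (r : ℝ) (fun t : ℝ => max 0 (t - r * ε)) (a : A) (by fun_prop)
      (by simp only [zero_sub]; exact max_eq_left (neg_nonpos.mpr (by positivity))),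
    ← cfcₙ_smul (r : ℝ) (fun t : ℝ => max 0 (t - ε)) (a : A) (by fun_prop) (by simp [hε])]
  congr 1
  funext t
  rw [smul_eq_mul, smul_eq_mul, ← mul_sub, mul_max_of_nonneg _ _ (NNReal.coe_nonneg r), mul_zero]

/-- The supremum of a weight over the cut-downs of an element: its largest lower semicontinuous
minorant when the weight is tracial. -/
noncomputable def regularize (f : Pos A → ℝ≥0∞) (a : Pos A) : ℝ≥0∞ :=
  ⨆ ε : {ε : ℝ // 0 < ε}, f (cutDown a ε)

theorem le_regularize (f : Pos A → ℝ≥0∞) (a : Pos A) {ε : ℝ} (hε : 0 < ε) :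
    f (cutDown a ε) ≤ regularize f a :=
  le_iSup (fun ε : {ε : ℝ // 0 < ε} => f (cutDown a ε)) ⟨ε, hε⟩

theorem regularize_le {f : Pos A → ℝ≥0∞} {a : Pos A} {c : ℝ≥0∞}
    (h : ∀ ε, 0 < ε → f (cutDown a ε) ≤ c) : regularize f a ≤ c := iSup_le fun ε => h ε ε.2

namespace IsTracial

variable {f : Pos A → ℝ≥0∞}

theorem apply_starMulSelf_mul_le (hf : IsTracial f) (c : A) {w : A} (hw : ‖w‖ ≤ 1) :
    f (starMulSelf (c * w)) ≤ f (starMulSelf c) := by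
  have hw' : ‖star (star w) * star w‖₊ ≤ 1 := by
    rw [CStarRing.nnnorm_star_mul_self, nnnorm_star]
    exact mul_le_one₀ hw zero_le hw
  calc f (starMulSelf (c * w)) = f (starMulSelf (star w * star c)) := by
        rw [← star_mul, hf.map_star]
    _ ≤ f (_ • starMulSelf (star c)) := hf.mono (starMulSelf_mul_le (star w) (star c))
    _ = ‖star (star w) * star w‖₊ * f (starMulSelf c) := by rw [hf.map_smul, hf.map_star]
    _ ≤ 1 * f (starMulSelf c) := by gcongr; exact_mod_cast hw'
    _ = f (starMulSelf c) := one_mul _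

theorem apply_cutDown_le_of_norm_sub_le (hf : IsTracial f) {x y : Pos A} {η δ : ℝ} (hηδ : η < δ)
    (hxy : ‖(x : A) - y‖ ≤ η) : f (cutDown x δ) ≤ f y := by
  obtain ⟨c, rfl⟩ := exists_eq_starMulSelf y
  obtain ⟨w, hw, hw1, hle⟩ := exists_cutDown_le_conjugate hηδ hxy
  refine (hf.mono ?_).trans (hf.apply_starMulSelf_mul_le c hw1)
  rwa [← Subtype.coe_le_coe, coe_starMulSelf_mul, hw.star_eq]

theorem regularize_le_self (hf : IsTracial f) (a : Pos A) : regularize f a ≤ f a :=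
  regularize_le fun _ hε => hf.mono (cutDown_le_self a hε.le)

theorem regularize_add_le (hf : IsTracial f) (a b : Pos A) :
    regularize f (a + b) ≤ regularize f a + regularize f b := by
  refine regularize_le fun ε hε => ?_
  have hdist : ‖((a + b : Pos A) : A) - (cutDown a (ε / 4) + cutDown b (ε / 4) : Pos A)‖ ≤ ε / 2 :=
    calc _ = ‖((a : A) - cutDown a (ε / 4)) + ((b : A) - cutDown b (ε / 4))‖ :=
          congrArg norm (add_sub_add_comm (a : A) b (cutDown a (ε / 4)) (cutDown b (ε / 4)))
      _ ≤ ε / 4 + ε / 4 := norm_add_le_of_le (norm_sub_cutDown_le a (by positivity))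
          (norm_sub_cutDown_le b (by positivity))
      _ = ε / 2 := by ring
  calc f (cutDown (a + b) ε) ≤ f (cutDown a (ε / 4) + cutDown b (ε / 4)) :=
        hf.apply_cutDown_le_of_norm_sub_le (half_lt_self hε) hdist
    _ = f (cutDown a (ε / 4)) + f (cutDown b (ε / 4)) := hf.map_add _ _
    _ ≤ _ := add_le_add (le_regularize f a (by positivity)) (le_regularize f b (by positivity))

/-- If `w (a + b) w` is a cut-down of `a + b`, where `a = c⋆c` and `b = d⋆d`, and `c w` and `d w`
are close to `c` and `d`, then small cut-downs of `a` and `b` are dominated under `f` by `w a w`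
and `w b w`. -/
theorem add_regularize_le (hf : IsTracial f) (a b : Pos A) :
    regularize f a + regularize f b ≤ regularize f (a + b) := by
  have : Nonempty {ε : ℝ // 0 < ε} := ⟨⟨1, one_pos⟩⟩
  refine ENNReal.iSup_add_iSup_le fun ⟨ε, hε⟩ ⟨δ, hδ⟩ => ?_
  obtain ⟨c, rfl⟩ := exists_eq_starMulSelf a
  obtain ⟨d, rfl⟩ := exists_eq_starMulSelf b
  have hcont : Continuous fun x : A => (starMulSelf x : A) :=
    continuous_subtype_val.comp continuous_starMulSelf
  obtain ⟨η₁, hη₁, hc⟩ :=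
    exists_norm_sub_le_of_norm_sub_sq_le hcont c (half_pos hε)
  obtain ⟨η₂, hη₂, hd⟩ :=
    exists_norm_sub_le_of_norm_sub_sq_le hcont d (half_pos hδ)
  have hη : 0 < min η₁ η₂ := lt_min hη₁ hη₂
  obtain ⟨w, hw, hconj, happrox⟩ :=
    exists_conjugate_eq_cutDown (starMulSelf c + starMulSelf d) hη
  have hcw := (happrox c (le_add_of_nonneg_right (starMulSelf d).2)).trans (min_le_left _ _)
  have hdw := (happrox d (le_add_of_nonneg_left (starMulSelf c).2)).trans (min_le_right _ _)
  have hsum : starMulSelf (c * w) + starMulSelf (d * w) =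
      cutDown (starMulSelf c + starMulSelf d) (min η₁ η₂) := by
    refine Subtype.ext (Eq.trans ?_ hconj)
    change (starMulSelf (c * w) : A) + starMulSelf (d * w) =
      w * ((starMulSelf c : A) + starMulSelf d) * w
    rw [coe_starMulSelf_mul, coe_starMulSelf_mul, hw.star_eq, mul_add, add_mul]
  calc f (cutDown (starMulSelf c) ε) + f (cutDown (starMulSelf d) δ)
      ≤ f (starMulSelf (c * w)) + f (starMulSelf (d * w)) := add_le_add
        (hf.apply_cutDown_le_of_norm_sub_le (half_lt_self hε) (hc _ hcw))
        (hf.apply_cutDown_le_of_norm_sub_le (half_lt_self hδ) (hd _ hdw))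
    _ = f (cutDown (starMulSelf c + starMulSelf d) (min η₁ η₂)) := by rw [← hf.map_add, hsum]
    _ ≤ _ := le_regularize f _ hη

theorem regularize_smul (hf : IsTracial f) {r : ℝ≥0} (hr : 0 < r) (a : Pos A) :
    regularize f (r • a) = r * regularize f a := by
  have hr' : (0 : ℝ) < r := hr
  refine le_antisymm (regularize_le fun ε hε => ?_) ?_
  · rw [← mul_div_cancel₀ ε hr'.ne', cutDown_smul a (by positivity), hf.map_smul]
    gcongr
    exact le_regularize f a (by positivity)
  · rw [regularize, ENNReal.mul_iSup]
    refine iSup_le fun ε => ?_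
    rw [← hf.map_smul, ← cutDown_smul a ε.2.le]
    exact le_regularize f _ (mul_pos hr' ε.2)

theorem regularize_starMulSelf_star_le (hf : IsTracial f) (x : A) :
    regularize f (starMulSelf (star x)) ≤ regularize f (starMulSelf x) := by
  refine regularize_le fun ε hε => ?_
  obtain ⟨η, hη, hx⟩ := exists_norm_sub_le_of_norm_sub_sq_le
    (continuous_subtype_val.comp (continuous_starMulSelf.comp continuous_star)) x (half_pos hε)
  obtain ⟨w, hw, hconj, happrox⟩ := exists_conjugate_eq_cutDown (starMulSelf x) hη
  have hcut : starMulSelf (x * w) = cutDown (starMulSelf x) η :=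
    Subtype.ext (by rw [coe_starMulSelf_mul, hw.star_eq, hconj])
  calc f (cutDown (starMulSelf (star x)) ε) ≤ f (starMulSelf (star (x * w))) :=
        hf.apply_cutDown_le_of_norm_sub_le (half_lt_self hε) (hx _ (happrox x le_rfl))
    _ = f (cutDown (starMulSelf x) η) := by rw [hf.map_star, hcut]
    _ ≤ _ := le_regularize f _ hη

theorem lowerSemicontinuous_regularize (hf : IsTracial f) :
    LowerSemicontinuous (regularize f) := by
  intro a r hr
  obtain ⟨⟨ε, hε⟩, h⟩ := lt_iSup_iff.mp hr
  filter_upwards [Metric.ball_mem_nhds a (show 0 < ε / 4 by positivity)] with b hb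
  rw [Metric.mem_ball, dist_comm, Subtype.dist_eq, dist_eq_norm] at hb
  have hdist : ‖(a : A) - cutDown b (ε / 4)‖ ≤ ε / 2 := calc
    _ ≤ ‖(a : A) - b‖ + ‖(b : A) - cutDown b (ε / 4)‖ := norm_sub_le_norm_sub_add_norm_sub _ _ _
    _ ≤ ε / 4 + ε / 4 := add_le_add hb.le (norm_sub_cutDown_le b (by positivity))
    _ = ε / 2 := by ring
  calc r < f (cutDown a ε) := h
    _ ≤ f (cutDown b (ε / 4)) := hf.apply_cutDown_le_of_norm_sub_le (half_lt_self hε) hdist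
    _ ≤ regularize f b := le_regularize f b (by positivity)

/-- The lower semicontinuous trace obtained by regularizing a tracial weight. -/
noncomputable def toTrace (hf : IsTracial f) : Trace A where
  toFun := regularize f
  map_zero' := le_zero_iff.mp (hf.map_zero ▸ hf.regularize_le_self 0)
  map_add' a b := (hf.regularize_add_le a b).antisymm (hf.add_regularize_le a b)
  map_smul' _ a hr := hf.regularize_smul hr a
  map_mul_star' x := by
    rw [← starMulSelf_star]
    refine (hf.regularize_starMulSelf_star_le x).antisymm ?_
    simpa only [star_star] using hf.regularize_starMulSelf_star_le (star x)
  lsc' := hf.lowerSemicontinuous_regularize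

theorem toTrace_apply (hf : IsTracial f) (a : Pos A) : hf.toTrace a = regularize f a := rfl

end IsTracial

end Trace

end Regularization

/-! ### Compactness in the cone of traces -/

section TraceCompactness

open Filter Topology

variable {A : Type u} [NonUnitalCStarAlgebra A] [PartialOrder A] [StarOrderedRing A]

namespace Trace

theorem apply_le_of_convergesTo {F : Filter (Trace A)} [F.NeBot] {σ τ : Trace A}
    (hσ : ConvergesTo F σ) (hτ : ConvergesTo F τ) (a : Pos A) : σ a ≤ τ a :=
  σ.le_of_forall_cutDown_le fun ε hε =>
    calc σ (cutDown a ε) ≤ liminf (fun ρ : Trace A => ρ (cutDown a ε)) F :=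
          (hσ (cutDown a ε) 1 one_pos).2
      _ ≤ limsup (fun ρ : Trace A => ρ (cutDown a ε)) F := liminf_le_limsup
      _ ≤ τ a := (hτ a ε hε).1

instance : T2Space (Trace A) := t2_iff_nhds.mpr fun {σ τ} _ =>
  have hσ : ConvergesTo (𝓝 σ ⊓ 𝓝 τ) σ := (le_nhds_iff _ σ).mp inf_le_left
  have hτ : ConvergesTo (𝓝 σ ⊓ 𝓝 τ) τ := (le_nhds_iff _ τ).mp inf_le_right
  ext fun a => (apply_le_of_convergesTo hσ hτ a).antisymm (apply_le_of_convergesTo hτ hσ a)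

theorem isTracial_of_tendsto {F : Filter (Trace A)} [F.NeBot] {f : Pos A → ℝ≥0∞}
    (hlim : ∀ a, Tendsto (fun σ : Trace A => σ a) F (𝓝 (f a))) : IsTracial f where
  map_add a b := tendsto_nhds_unique (hlim (a + b)) <|
    ((hlim a).add (hlim b)).congr fun σ => (σ.isTracial.map_add a b).symm
  map_smul r a := tendsto_nhds_unique (hlim (r • a)) <|
    (ENNReal.Tendsto.const_mul (hlim a) (.inr ENNReal.coe_ne_top)).congr fun σ =>
      (σ.isTracial.map_smul r a).symm
  map_star x := tendsto_nhds_unique (hlim _) <|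
    (hlim (starMulSelf x)).congr fun σ => (σ.isTracial.map_star x).symm

theorem convergesTo_toTrace {F : Filter (Trace A)} [F.NeBot] {f : Pos A → ℝ≥0∞}
    (hf : IsTracial f) (hlim : ∀ a, Tendsto (fun σ : Trace A => σ a) F (𝓝 (f a))) :
    ConvergesTo F hf.toTrace := by
  refine fun a ε hε => ⟨?_, ?_⟩
  · rw [(hlim _).limsup_eq]
    exact le_regularize f a hε
  · rw [(hlim _).liminf_eq]
    exact hf.regularize_le_self a

theorem cutDown_le_cutDown_cutDown_add_smul (a : Pos A) {ε : ℝ} (hε : 0 < ε) (r : ℝ≥0) :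
    cutDown a ε ≤ cutDown (cutDown a ε) (r * (ε / 2)) + r • cutDown a (ε / 2) := by
  have hzero : ∀ δ : ℝ, 0 ≤ δ → max 0 (0 - δ) = 0 := fun δ hδ => by simpa using hδ
  have hrε : 0 ≤ r * (ε / 2) := by positivity
  rw [cutDown_cutDown a hε.le hrε, ← Subtype.coe_le_coe]
  change (cutDown a ε : A) ≤ cutDown a (ε + r * (ε / 2)) + (r • cutDown a (ε / 2) : Pos A)
  rw [coe_smul, coe_cutDown, coe_cutDown, coe_cutDown,
    ← cfcₙ_const_mul (r : ℝ) (fun t : ℝ => max 0 (t - ε / 2)) (a : A) (by fun_prop)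
      (hzero _ (by positivity)),
    ← cfcₙ_add (fun t : ℝ => max 0 (t - (ε + r * (ε / 2)))) (fun t : ℝ => r * max 0 (t - ε / 2))
      (a : A) (by fun_prop) (hzero _ (by positivity)) (by fun_prop)
      (by rw [hzero _ (by positivity), mul_zero])]
  refine cfcₙ_mono (fun t _ => ?_) (by fun_prop) (by fun_prop) (hzero _ hε.le)
    (by rw [hzero _ (by positivity), hzero _ (by positivity), mul_zero, add_zero])
  refine max_le (by positivity) ?_
  rcases le_total t ε with ht | ht
  · exact (sub_nonpos.mpr ht).trans (by positivity)
  · have hlower : r * (ε / 2) ≤ r * max 0 (t - ε / 2) := by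
      gcongr
      exact le_max_of_le_right (by linarith)
    linarith [le_max_right 0 (t - (ε + r * (ε / 2)))]

namespace IsTracial

variable {f : Pos A → ℝ≥0∞}

theorem regularize_cutDown (hf : IsTracial f) {a : Pos A} {ε : ℝ} (hε : 0 < ε)
    (hfin : f (cutDown a (ε / 2)) < ∞) : regularize f (cutDown a ε) = f (cutDown a ε) := by
  refine (hf.regularize_le_self _).antisymm ?_
  have hbound : ∀ r : ℝ≥0, 0 < r →
      f (cutDown a ε) ≤ regularize f (cutDown a ε) + r * f (cutDown a (ε / 2)) := fun r hr =>
    calc f (cutDown a ε)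
        ≤ f (cutDown (cutDown a ε) (r * (ε / 2)) + r • cutDown a (ε / 2)) :=
          hf.mono (cutDown_le_cutDown_cutDown_add_smul a hε r)
      _ = f (cutDown (cutDown a ε) (r * (ε / 2))) + r * f (cutDown a (ε / 2)) := by
          rw [hf.map_add, hf.map_smul]
      _ ≤ _ := by
          gcongr
          exact le_regularize f _ (mul_pos hr (half_pos hε))
  have hlim : Tendsto (fun r : ℝ≥0 => regularize f (cutDown a ε) + r * f (cutDown a (ε / 2)))
      (𝓝[>] 0) (𝓝 (regularize f (cutDown a ε) + (0 : ℝ≥0) * f (cutDown a (ε / 2)))) :=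
    tendsto_const_nhds.add <| ENNReal.Tendsto.mul_const
      (ENNReal.tendsto_coe.mpr (tendsto_id.mono_left nhdsWithin_le_nhds)) (.inr hfin.ne)
  rw [ENNReal.coe_zero, zero_mul, add_zero] at hlim
  exact ge_of_tendsto hlim (eventually_nhdsWithin_of_forall hbound)

theorem regularize_eq_of_mem_pedersenIdeal (hf : IsTracial f) {I : ClosedIdeal A}
    (hfin : ∀ a : Pos A, (a : A) ∈ I → ∀ ε, 0 < ε → f (cutDown a ε) < ∞) {e : I}
    (he : 0 ≤ (e : A)) (heP : e ∈ pedersenIdeal I) : regularize f ⟨e, he⟩ = f ⟨e, he⟩ := by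
  have hC := isInvariantOrderIdeal_eq hf.toTrace.isTracial hf hf.regularize_le_self
  exact (hC.mem_of_mem_pedersenIdeal (fun a ha ε hε =>
    ⟨hf.regularize_cutDown hε (hfin a ha _ (half_pos hε)), hfin a ha ε hε⟩) he heP).1

end IsTracial

theorem toTrace_mem_supportedOn {F : Filter (Trace A)} [F.NeBot] {f : Pos A → ℝ≥0∞}
    (hf : IsTracial f) (hlim : ∀ a, Tendsto (fun σ : Trace A => σ a) F (𝓝 (f a)))
    {I : ClosedIdeal A} (hF : ∀ᶠ σ in F, σ ∈ supportedOn I)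
    (hfin : ∀ a : Pos A, (a : A) ∈ I → ∀ ε, 0 < ε → f (cutDown a ε) < ∞) :
    hf.toTrace ∈ supportedOn I := by
  refine mem_supportedOn_iff.mpr ⟨fun a ha ε hε =>
    (hf.regularize_le_self _).trans_lt (hfin a ha ε hε), fun a ha => ?_⟩
  obtain ⟨ε, hε, hnotMem⟩ : ∃ ε, 0 < ε ∧ (cutDown a ε : A) ∉ I := by
    by_contra! h
    exact ha (mem_of_forall_cutDown_mem I h)
  have htop : f (cutDown a ε) = ∞ := tendsto_nhds_unique (hlim _) <|
    tendsto_const_nhds.congr' (hF.mono fun σ hσ => ((mem_supportedOn_iff.mp hσ).2 _ hnotMem).symm)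
  exact top_le_iff.mp (htop.ge.trans (le_regularize f a hε))

theorem convex_normalizedAt (I : ClosedIdeal A) (e : Pos A) : Convex ℝ≥0 (normalizedAt I e) := by
  refine convex_iff_forall_pos.mpr fun σ hσ τ hτ s t hs ht hst => ?_
  have hC := isSubcone_supportedOn I
  refine ⟨hC.add_mem _ (hC.smul_mem s hs σ hσ.1) _ (hC.smul_mem t ht τ hτ.1), ?_⟩
  rw [add_apply, smul_apply, smul_apply, hσ.2, hτ.2, mul_one, mul_one, ← ENNReal.coe_add, hst,
    ENNReal.coe_one]

section FullElement

variable {I : ClosedIdeal A} {e : I} (he : 0 ≤ (e : A)) (hef : IsFull e)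

include hef

theorem exists_forall_cutDown_le_mul_of_isFull {a : Pos A} (ha : (a : A) ∈ I) {ε : ℝ}
    (hε : 0 < ε) : ∃ c : ℝ≥0, ∀ σ : Trace A, σ (cutDown a ε) ≤ c * σ ⟨e, he⟩ :=
  exists_forall_cutDown_le_mul (A := A) (e := ⟨(e : A), he⟩)
    ((ClosedIdeal.isFull_iff.mp hef).ge ha) hε

theorem eq_ofIdeal_of_apply_eq_zero {τ : Trace A} (hτ : τ ∈ supportedOn I)
    (h0 : τ ⟨e, he⟩ = 0) : τ = ofIdeal I := by
  refine ext fun a => ?_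
  by_cases ha : (a : A) ∈ I
  · rw [ofIdeal_of_mem ha, ← le_zero_iff]
    refine τ.le_of_forall_cutDown_le fun ε hε => ?_
    obtain ⟨c, hc⟩ := exists_forall_cutDown_le_mul_of_isFull he hef ha hε
    exact (hc τ).trans_eq (by rw [h0, mul_zero])
  · rw [ofIdeal_of_notMem ha, (mem_supportedOn_iff.mp hτ).2 a ha]

variable (heP : e ∈ pedersenIdeal I)

include heP

/-- An ultrafilter converges pointwise, but the pointwise limit need not be lower semicontinuous.
Its regularization is the limit in `T(A)`, and regularizing does not change the value at `e`. -/
theorem exists_le_nhds_of_eventually_le (F : Ultrafilter (Trace A)) {R : ℝ≥0}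
    (hF : ∀ᶠ σ in F, σ ∈ supportedOn I ∧ σ ⟨e, he⟩ ≤ R) :
    ∃ τ ∈ supportedOn I, (F : Filter (Trace A)) ≤ 𝓝 τ ∧
      Tendsto (fun σ : Trace A => σ ⟨e, he⟩) F (𝓝 (τ ⟨e, he⟩)) := by
  choose f hlim using fun a : Pos A =>
    (⟨_, (F.map fun σ : Trace A => σ a).le_nhds_lim⟩ :
      ∃ l : ℝ≥0∞, Tendsto (fun σ : Trace A => σ a) F (𝓝 l))
  have hf : IsTracial f := isTracial_of_tendsto hlim
  have hfin : ∀ a : Pos A, (a : A) ∈ I → ∀ ε, 0 < ε → f (cutDown a ε) < ∞ := by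
    intro a ha ε hε
    obtain ⟨c, hc⟩ := exists_forall_cutDown_le_mul_of_isFull he hef ha hε
    have hle : f (cutDown a ε) ≤ c * R := le_of_tendsto (hlim _) <| hF.mono fun σ hσ =>
      (hc σ).trans (mul_le_mul_right hσ.2 _)
    exact hle.trans_lt (ENNReal.mul_lt_top ENNReal.coe_lt_top ENNReal.coe_lt_top)
  refine ⟨hf.toTrace, toTrace_mem_supportedOn hf hlim (hF.mono fun _ hσ => hσ.1) hfin,
    (le_nhds_iff _ _).mpr (convergesTo_toTrace hf hlim), ?_⟩
  rw [hf.toTrace_apply, hf.regularize_eq_of_mem_pedersenIdeal hfin he heP]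
  exact hlim _

theorem isCompact_setOf_apply_le (R : ℝ≥0) :
    IsCompact {σ : Trace A | σ ∈ supportedOn I ∧ σ ⟨e, he⟩ ≤ R} := by
  refine isCompact_iff_ultrafilter_le_nhds.mpr fun F hF => ?_
  have hF' : ∀ᶠ σ in F, σ ∈ supportedOn I ∧ σ ⟨e, he⟩ ≤ R := le_principal_iff.mp hF
  obtain ⟨τ, hτ, hle, hlim⟩ := exists_le_nhds_of_eventually_le he hef heP F hF'
  exact ⟨τ, ⟨hτ, le_of_tendsto hlim (hF'.mono fun _ hσ => hσ.2)⟩, hle⟩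

theorem isCompact_normalizedAt : IsCompact (normalizedAt I ⟨e, he⟩) := by
  refine isCompact_iff_ultrafilter_le_nhds.mpr fun F hF => ?_
  have hF' : ∀ᶠ σ in F, σ ∈ supportedOn I ∧ σ ⟨e, he⟩ = 1 := le_principal_iff.mp hF
  obtain ⟨τ, hτ, hle, hlim⟩ := exists_le_nhds_of_eventually_le he hef heP F (R := 1)
    (hF'.mono fun σ hσ => ⟨hσ.1, hσ.2.le.trans_eq ENNReal.coe_one.symm⟩)
  have hone : τ ⟨e, he⟩ = 1 := tendsto_nhds_unique hlim <|
    tendsto_const_nhds.congr' (hF'.mono fun _ hσ => hσ.2.symm)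
  exact ⟨τ, ⟨hτ, hone⟩, hle⟩

theorem existsUnique_smul_eq {τ : Trace A} (hτ : τ ∈ supportedOn I) (hne : τ ≠ ofIdeal I) :
    ∃! p : ℝ≥0 × Trace A, 0 < p.1 ∧ p.2 ∈ normalizedAt I ⟨e, he⟩ ∧ p.1 • p.2 = τ := by
  obtain ⟨r, hr⟩ : ∃ r : ℝ≥0, (r : ℝ≥0∞) = τ ⟨e, he⟩ :=
    WithTop.ne_top_iff_exists.mp (lt_top_of_mem_pedersenIdeal hτ he heP).ne
  have hr0 : r ≠ 0 := by
    rintro rfl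
    exact hne (eq_ofIdeal_of_apply_eq_zero he hef hτ hr.symm)
  have hmem : r⁻¹ • τ ∈ supportedOn I :=
    (isSubcone_supportedOn I).smul_mem r⁻¹ (by positivity) τ hτ
  refine ⟨(r, r⁻¹ • τ), ⟨by positivity, ⟨hmem, ?_⟩, smul_inv_smul₀ hr0 τ⟩, ?_⟩
  · rw [smul_apply, ← hr, ← ENNReal.coe_mul, inv_mul_cancel₀ hr0, ENNReal.coe_one]
  · rintro ⟨s, σ⟩ ⟨-, ⟨-, hσ⟩, rfl⟩
    have hrs : r = s := by
      rwa [smul_apply, hσ, mul_one, ENNReal.coe_inj] at hr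
    rw [← hrs, inv_smul_smul₀ hr0]

theorem isCompactBase_normalizedAt :
    IsCompactBase (supportedOn I) (ofIdeal I) (normalizedAt I ⟨e, he⟩) where
  subset _ hτ := hτ.1
  isCompact := isCompact_normalizedAt he hef heP
  convex := convex_normalizedAt I _
  neutral_notMem h := zero_ne_one ((ofIdeal_of_mem e.2).symm.trans h.2)
  existsUnique _ := existsUnique_smul_eq he hef heP

include he in
/-- A compact neighbourhood of `τ` is `{σ | σ b ≤ r}` for `r > τ e` and a cut-down `b` of `e` that
is still full: on `T(A)`, evaluation at `e` itself is only lower semicontinuous. -/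
theorem locallyCompactSpace_supportedOn : LocallyCompactSpace (supportedOn I) := by
  obtain ⟨ε, hε, hspan⟩ := ClosedIdeal.exists_span_cutDown_eq (A := A) (b := ⟨(e : A), he⟩)
    ((ClosedIdeal.isFull_iff.mp hef).symm ▸ ClosedIdeal.isCompactElement_of_isFull heP hef)
  set b : Pos A := cutDown ⟨e, he⟩ ε
  have hbI : (b : A) ∈ I := cutDown_mem I e.2 ε
  have hbP : ⟨b, hbI⟩ ∈ pedersenIdeal I := cutDown_mem_pedersenIdeal I e.2 hε
  have hbf : IsFull (⟨b, hbI⟩ : I) :=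
    ClosedIdeal.isFull_iff.mpr (hspan.trans (ClosedIdeal.isFull_iff.mp hef))
  suffices WeaklyLocallyCompactSpace (supportedOn I) from inferInstance
  refine ⟨fun τ => ?_⟩
  obtain ⟨r, hr⟩ : ∃ r : ℝ≥0, τ.1 ⟨e, he⟩ < r :=
    ENNReal.lt_iff_exists_nnreal_btwn.mp (lt_top_of_mem_pedersenIdeal τ.2 he heP)
      |>.imp fun _ h => h.1
  refine ⟨Subtype.val ⁻¹' {σ : Trace A | σ ∈ supportedOn I ∧ σ b ≤ r},
    IsInducing.subtypeVal.isCompact_preimage' (isCompact_setOf_apply_le b.2 hbf hbP r)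
      fun σ hσ => ⟨⟨σ, hσ.1⟩, rfl⟩, ?_⟩
  have hlimsup : limsup (fun σ : Trace A => σ b) (𝓝 τ.1) < r :=
    ((le_nhds_iff (𝓝 τ.1) τ.1).mp le_rfl ⟨e, he⟩ ε hε).1.trans_lt hr
  filter_upwards [continuous_subtype_val.continuousAt.eventually
    (eventually_lt_of_limsup_lt hlimsup)] with σ hσ using ⟨σ.2, hσ.le⟩

end FullElement

end Trace

end TraceCompactness

end CStarTrace

theorem mainTheorem9 {A : Type u} [NonUnitalCStarAlgebra A] [PartialOrder A] [StarOrderedRing A]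
    (I : CStarTrace.ClosedIdeal A) :
    List.TFAE
      [I.IsSinglyGenerated ∧ IsCompactElement I,
        ∃ e : I, e ∈ CStarTrace.pedersenIdeal I ∧ CStarTrace.IsFull e,
        CompactSpace (CStarTrace.Prim I)] ∧
    ((I.IsSinglyGenerated ∧ IsCompactElement I) ∨
        (∃ e : I, e ∈ CStarTrace.pedersenIdeal I ∧ CStarTrace.IsFull e) ∨
        CompactSpace (CStarTrace.Prim I) →
      CStarTrace.Trace.IsSubcone (CStarTrace.Trace.supportedOn I) (CStarTrace.Trace.ofIdeal I) ∧
      CStarTrace.Trace.IsCancellative (CStarTrace.Trace.supportedOn I) ∧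
      LocallyCompactSpace (CStarTrace.Trace.supportedOn I) ∧
      (∃ e : I, 0 ≤ (e : A) ∧ e ∈ CStarTrace.pedersenIdeal I ∧ CStarTrace.IsFull e) ∧
      ∀ (e : I) (he : 0 ≤ (e : A)), e ∈ CStarTrace.pedersenIdeal I → CStarTrace.IsFull e →
        CStarTrace.Trace.IsCompactBase (CStarTrace.Trace.supportedOn I)
          (CStarTrace.Trace.ofIdeal I) (CStarTrace.Trace.normalizedAt I ⟨(e : A), he⟩)) := by
  have htfae := I.tfae_compact
  refine ⟨htfae, fun h => ?_⟩
  obtain ⟨hgen, hcompact⟩ : I.IsSinglyGenerated ∧ IsCompactElement I := by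
    rcases h with h | h | h
    · exact h
    · exact (htfae.out 1 0).mp h
    · exact (htfae.out 2 0).mp h
  obtain ⟨e, he, heP, hef⟩ :=
    CStarTrace.ClosedIdeal.exists_isFull_of_isCompactElement hgen hcompact
  exact ⟨CStarTrace.Trace.isSubcone_supportedOn I, CStarTrace.Trace.isCancellative_supportedOn I,
    CStarTrace.Trace.locallyCompactSpace_supportedOn he hef heP, ⟨e, he, heP, hef⟩,
    fun _ he heP hef => CStarTrace.Trace.isCompactBase_normalizedAt he hef heP⟩
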